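/- Let $n$ be a natural number, let $\mathrm{Sym}_n$ be the space of real symmetric $n\times n$ matrices and let $\mathrm{Sym}_n^+$ be the manifold of symmetric positive definite $n\times n$ matrices, with tangent space $\mathrm{Sym}_n$ at every point. Equip $\mathrm{Sym}_n^+$ with one of the following Riemannian metrics, where $P\in\mathrm{Sym}_n^+$ and $V,W\in\mathrm{Sym}_n$: - the Log-Euclidean metric $\langle V,W\rangle_P=\langle D\log_P(V),D\log_P(W)\rangle_F$, where $\log$ is the matrix logarithm and $\langle\cdot,\cdot\rangle_F$ the Frobenius inner product; - the Log-Cholesky metric $\langle V,W\rangle_P=\sum_{i>j}X_{ij}Y_{ij}+\sum_j L_{jj}^{-2}X_{jj}Y_{jj}$, where $P=LL^{T}$ with $L$ lower triangular with positive diagonal, $X=L(L^{-1}VL^{-T})_{1/2}$, $Y=L(L^{-1}WL^{-T})_{1/2}$, and $Z_{1/2}$ is the lower triangular part of $Z$ with the diagonal entries halved; - the Affine-Invariant metric $\langle V,W\rangle_P=\operatorname{tr}(P^{-1}VP^{-1}W)=\langle P^{-1/2}VP^{-1/2},P^{-1/2}WP^{-1/2}\rangle_F$. Let $\operatorname{Exp}_P$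 and $\operatorname{Log}_P$ be the Riemannian exponential and logarithmic maps at $P$ of the chosen metric, and let $\mathcal T_{P\to Q}$ be the parallel transport (of its Levi-Civita connection) from $P$ to $Q$ along the geodesic connecting $P$ and $Q$. With $I$ the identity matrix, put $$P\oplus Q=\operatorname{Exp}_P\big(\mathcal T_{I\to P}(\operatorname{Log}_I(Q))\big),$$ let $\ominus P$ be the left inverse of $P$, that is $\ominus P\oplus P=I$, and define $$\langle P,Q\rangle=\langle\operatorname{Log}_I(P),\operatorname{Log}_I(Q)\rangle_I,\qquad \|P\|=\sqrt{\langle P,P\rangle},\qquad d(P,Q)=\|\ominus P\oplus Q\|.$$ Theorem. For each of the three metrics and every $A\in\mathrm{Sym}_n^+$, the left gyrotranslation $Q\mapsto A\oplus Q$ is a gyroisometry of $\mathrm{Sym}_n^+$: for all $P,Q\in\mathrm{Sym}_n^+$, $$d(A\oplus P,\,A\oplus Q)=d(P,Q).$$ -/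

import Mathlib

noncomputable section

namespace SPDGyro

open Matrix Set

/-- Real `n × n` matrices. -/
abbrev Mat (n : ℕ) := Matrix (Fin n) (Fin n) ℝ

/-- The manifold `Sym_n⁺` of real symmetric positive definite `n × n` matrices. It is an open subset
of the vector space of symmetric matrices, which is therefore its tangent space at every point. -/
abbrev SPD (n : ℕ) := {P : Mat n // P.PosDef}

/-- The identity matrix as a point of `Sym_n⁺`. -/
def SPD.one (n : ℕ) : SPD n := ⟨1, Matrix.PosDef.one⟩

instance (n : ℕ) : Nonempty (SPD n) := ⟨SPD.one n⟩

/-! ### The three Riemannian metrics -/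

/-- A (0,2)-tensor on `Sym_n⁺`: `g P V W` is the inner product at the point `P` of the tangent
vectors `V` and `W`. Only the values at `P` positive definite and `V`, `W` symmetric matter. -/
abbrev MetricTensor (n : ℕ) := Mat n → Mat n → Mat n → ℝ

/-- The Frobenius inner product. -/
def frobenius {n : ℕ} (V W : Mat n) : ℝ := ∑ i, ∑ j, V i j * W i j

/-- The principal matrix logarithm of a symmetric matrix (functional calculus). -/
def matLog {n : ℕ} (P : Mat n) : Mat n := cfc Real.log P

/-- The directional derivative of the matrix logarithm at `P` along `V`, entry by entry. -/
def dMatLog {n : ℕ} (P V : Mat n) : Mat n :=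
  Matrix.of fun i j => lineDeriv ℝ (fun X : Mat n => matLog X i j) P V

/-- The Log-Euclidean metric `⟨D log_P V, D log_P W⟩_F`. -/
def leMetric (n : ℕ) : MetricTensor n := fun P V W => frobenius (dMatLog P V) (dMatLog P W)

/-- `L` is the Cholesky factor of `P`: it is lower triangular with positive diagonal entries and
`P = L Lᵀ`. -/
structure IsCholeskyFactor {n : ℕ} (P L : Mat n) : Prop where
  lower : ∀ i j, i < j → L i j = 0
  diag_pos : ∀ i, 0 < L i i
  mul_transpose : L * Lᵀ = P

/-- The Cholesky factor of a positive definite matrix. -/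
def cholesky {n : ℕ} (P : Mat n) : Mat n := Classical.epsilon fun L => IsCholeskyFactor P L

/-- The lower triangular part of a matrix with the diagonal entries halved. -/
def lowerHalf {n : ℕ} (Y : Mat n) : Mat n :=
  Matrix.of fun i j => if j < i then Y i j else if i = j then Y i j / 2 else 0

/-- The differential `W ↦ L (L⁻¹ W L⁻ᵀ)_{1/2}` of the Cholesky map at `P`, with `L = cholesky P`. -/
def dCholesky {n : ℕ} (P W : Mat n) : Mat n :=
  cholesky P * lowerHalf ((cholesky P)⁻¹ * W * ((cholesky P)⁻¹)ᵀ)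

/-- The metric at `L` on lower triangular matrices with positive diagonal entries: Euclidean on the
strictly lower part, and the metric of `log L_jj` on the diagonal. -/
def triMetric (n : ℕ) : MetricTensor n := fun L X Y =>
  (∑ i, ∑ j, if j < i then X i j * Y i j else 0) + ∑ j, X j j * Y j j / (L j j) ^ 2

/-- The Log-Cholesky metric: the pull-back of `triMetric` under the Cholesky map. -/
def lcMetric (n : ℕ) : MetricTensor n := fun P V W =>
  triMetric n (cholesky P) (dCholesky P V) (dCholesky P W)

/-- The Affine-Invariant metric `tr (P⁻¹ V P⁻¹ W) = ⟨P^{-1/2} V P^{-1/2}, P^{-1/2} W P^{-1/2}⟩_F`. -/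
def aiMetric (n : ℕ) : MetricTensor n := fun P V W => (P⁻¹ * V * P⁻¹ * W).trace

/-- The names of the three metrics: Log-Euclidean, Log-Cholesky, Affine-Invariant. -/
inductive MetricName
  | le
  | lc
  | ai

/-- The metric with a given name. -/
def MetricName.tensor (g : MetricName) (n : ℕ) : MetricTensor n :=
  match g with
  | .le => leMetric n
  | .lc => lcMetric n
  | .ai => aiMetric n

/-! ### Levi-Civita parallel transport and geodesics -/

section Riemannian

variable {n : ℕ} (g : MetricTensor n)

/-- The Christoffel symbols of the first kind at `P`, in the global chart given by the vector space
of symmetric matrices: by Koszul's formula for constant vector fields this is `g_P (∇_U V, W)` for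
the Levi-Civita connection. -/
def christoffel (P U V W : Mat n) : ℝ :=
  (lineDeriv ℝ (fun X : Mat n => g X V W) P U + lineDeriv ℝ (fun X : Mat n => g X U W) P V
    - lineDeriv ℝ (fun X : Mat n => g X U V) P W) / 2

/-- `γ : [0,1] → Sym_n⁺` is a differentiable curve with velocity `v`. -/
def IsCurve (γ v : ℝ → Mat n) : Prop :=
  ∀ t ∈ Icc (0 : ℝ) 1, (γ t).PosDef ∧ HasDerivWithinAt γ (v t) (Icc 0 1) t

/-- `X` is a parallel vector field along the curve `γ : [0,1] → Sym_n⁺` with velocity `v`, for the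
Levi-Civita connection of `g`: the covariant derivative of `X` along `γ`, that is, `X'` plus the
Christoffel term, is orthogonal to every tangent vector `W`. -/
def IsParallelAlong (γ v X : ℝ → Mat n) : Prop :=
  ∀ t ∈ Icc (0 : ℝ) 1, (X t).IsSymm ∧ ∃ X' : Mat n, HasDerivWithinAt X X' (Icc 0 1) t ∧
    ∀ W : Mat n, W.IsSymm → g (γ t) X' W + christoffel g (γ t) (v t) (X t) W = 0

/-- `γ : [0,1] → Sym_n⁺` is a geodesic with velocity `v`: its velocity is parallel along it. -/
def IsGeodesic (γ v : ℝ → Mat n) : Prop :=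
  IsCurve γ v ∧ IsParallelAlong g γ v v

/-- The Riemannian exponential map: the endpoint at time `1` of the geodesic that starts at `P` with
velocity `V`. -/
def riemExp (P : SPD n) (V : Mat n) : SPD n :=
  Classical.epsilon fun Q : SPD n =>
    ∃ γ v, IsGeodesic g γ v ∧ γ 0 = P.1 ∧ v 0 = V ∧ γ 1 = Q.1

/-- The Riemannian logarithmic map: the initial velocity of the geodesic from `P` to `Q`. -/
def riemLog (P Q : SPD n) : Mat n :=
  Classical.epsilon fun V : Mat n =>
    ∃ γ v, IsGeodesic g γ v ∧ γ 0 = P.1 ∧ γ 1 = Q.1 ∧ v 0 = V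

/-- Parallel transport of a tangent vector `V` at `P` to `Q` along the geodesic from `P` to `Q`. -/
def transport (P Q : SPD n) (V : Mat n) : Mat n :=
  Classical.epsilon fun W : Mat n =>
    ∃ γ v X, IsGeodesic g γ v ∧ γ 0 = P.1 ∧ γ 1 = Q.1 ∧
      IsParallelAlong g γ v X ∧ X 0 = V ∧ X 1 = W

/-! ### The gyrovector operations, the gyrodistance and gyroisometries -/

/-- The binary operation `P ⊕ Q = Exp_P (T_{I → P} (Log_I Q))`. -/
def gyroAdd (P Q : SPD n) : SPD n :=
  riemExp g P (transport g (SPD.one n) P (riemLog g (SPD.one n) Q))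

/-- The left inverse `⊖ P`, with `⊖ P ⊕ P = I`. -/
def gyroNeg (P : SPD n) : SPD n :=
  Classical.epsilon fun N : SPD n => gyroAdd g N P = SPD.one n

/-- The SPD inner product `⟨P, Q⟩ = ⟨Log_I P, Log_I Q⟩_I`. -/
def spdInner (P Q : SPD n) : ℝ :=
  g 1 (riemLog g (SPD.one n) P) (riemLog g (SPD.one n) Q)

/-- The SPD norm. -/
def spdNorm (P : SPD n) : ℝ := √(spdInner g P P)

/-- The SPD gyrodistance `d(P, Q) = ‖⊖ P ⊕ Q‖`. -/
def gyroDist (P Q : SPD n) : ℝ := spdNorm g (gyroAdd g (gyroNeg g P) Q)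

/-- SPD gyroisometries: the maps that preserve the SPD gyrodistance. -/
def IsGyroisometry (ω : SPD n → SPD n) : Prop :=
  ∀ P Q : SPD n, gyroDist g (ω P) (ω Q) = gyroDist g P Q

/-- The left SPD gyrotranslation by `P`. -/
def leftGyrotranslation (P : SPD n) : SPD n → SPD n := fun Q => gyroAdd g P Q

end Riemannian

end SPDGyro

end

noncomputable section

namespace SPDGyro

open Matrix Set Filter Topology NormedSpace
open scoped Matrix.Norms.L2Operator

variable {n : ℕ}

/-! ### Exponential and logarithm of symmetric matrices -/

section ExpLog

/-! For the Log-Euclidean and Log-Cholesky metrics there is a global chart φ onto a vector space in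
which the metric is a constant definite form (`FlatChart`). Koszul's formula then expresses the
Levi-Civita connection through D²φ, so Dφ(X) is constant for a parallel field X and geodesics are
straight lines in the chart. Hence φ(P ⊕ Q) = φ(P) + φ(Q) − φ(I), and d(P, Q) is the norm of φ(Q) −
φ(P) (`gyroDist_eq`): a left gyrotranslation is a translation in the chart. Both charts are inverses
of explicit smooth maps, and their regularity comes from the inverse function theorem
(`exists_contDiffAt_local_inverse`).

The Affine-Invariant metric is not flat for n ≥ 2, so its differential equations are solved
explicitly. They give P ⊕ Q = P^{1/2} Q P^{1/2} (`gyroAdd_aiMetric`) and d(P, Q)² = tr((log KQK)²)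
for a symmetric K with KPK = I (`gyroDist_aiMetric`). Translating P and Q changes KQK by an
orthogonal conjugation (`exists_orthogonal_conj`), which commutes with log and preserves the trace.

Exp, Log, transport and ⊖ are choices made by `Classical.epsilon`, so each evaluation needs an
explicit witness and a formula valid for every witness. -/

theorem isHermitian_iff_isSymm {A : Mat n} : A.IsHermitian ↔ A.IsSymm := by
  rw [Matrix.IsHermitian, Matrix.IsSymm, conjTranspose_eq_transpose_of_trivial]

theorem isSymm_of_posDef {P : Mat n} (hP : P.PosDef) : P.IsSymm :=
  isHermitian_iff_isSymm.1 hP.isHermitian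

theorem matLog_isSymm (P : Mat n) : (matLog P).IsSymm :=
  isHermitian_iff_isSymm.1 (cfc_predicate Real.log P)

theorem matLog_exp {A : Mat n} (hA : A.IsSymm) : matLog (exp A) = A :=
  CFC.log_exp A (isHermitian_iff_isSymm.2 hA)

theorem exp_matLog {P : Mat n} (hP : P.PosDef) : exp (matLog P) = P := by
  have hpos : ∀ x ∈ spectrum ℝ P, 0 < x := by
    intro x hx
    rw [hP.isHermitian.spectrum_real_eq_range_eigenvalues] at hx
    obtain ⟨i, rfl⟩ := hx
    exact hP.eigenvalues_pos i
  have hcont : ContinuousOn Real.log (spectrum ℝ P) :=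
    Real.continuousOn_log.mono fun x hx => (hpos x hx).ne'
  have hcomp : cfc (fun x => Real.exp (Real.log x)) P = cfc Real.exp (matLog P) :=
    cfc_comp' Real.exp Real.log P (by fun_prop) hcont hP.isHermitian
  have hid : cfc (fun x => Real.exp (Real.log x)) P = P :=
    (cfc_congr fun x hx => Real.exp_log (hpos x hx)).trans (cfc_id ℝ P hP.isHermitian)
  exact (CFC.real_exp_eq_normedSpace_exp (cfc_predicate Real.log P)).symm.trans
    (hcomp.symm.trans hid)

/-- exp A = BᵀB with B = exp(A/2), which is symmetric and invertible. -/
theorem exp_posDef {A : Mat n} (hA : A.IsSymm) : (exp A).PosDef := by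
  have h2 : ((2⁻¹ : ℝ) • A).IsSymm := hA.smul _
  have h : exp A = (exp ((2⁻¹ : ℝ) • A))ᴴ * exp ((2⁻¹ : ℝ) • A) := by
    rw [conjTranspose_eq_transpose_of_trivial, ← Matrix.exp_transpose, h2.eq,
      ← Matrix.exp_add_of_commute _ _ (Commute.refl _), ← add_smul]
    norm_num
  rw [h]
  exact Matrix.PosDef.conjTranspose_mul_self _
    (Matrix.mulVec_injective_of_isUnit (Matrix.isUnit_exp _))

theorem contDiff_exp_mat {k : WithTop ℕ∞} : ContDiff ℝ k (exp : Mat n → Mat n) :=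
  contDiff_iff_contDiffAt.2 fun A => (NormedSpace.exp_analytic (𝕂 := ℝ) A).contDiffAt

/-- No formula for the differential of exp is needed. Differentiating the commutation of A + tV with
exp(A + tV), when the exponential has zero derivative, shows that V commutes with exp A, hence with
its logarithm A. The derivative is then exp(A) V, which vanishes only for V = 0. -/
theorem fderiv_exp_injective {A : Mat n} (hA : A.IsSymm) {V : Mat n}
    (h : fderiv ℝ (exp : Mat n → Mat n) A V = 0) : V = 0 := by
  have hd : ∀ B : Mat n, HasFDerivAt (exp : Mat n → Mat n) (fderiv ℝ exp B) B := fun B =>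
    ((contDiff_exp_mat (k := 1)).differentiable one_ne_zero B).hasFDerivAt
  have hline : HasDerivAt (fun t : ℝ => A + t • V) V 0 := by
    simpa using ((hasDerivAt_id (0 : ℝ)).smul_const V).const_add A
  have hexp : HasDerivAt (fun t : ℝ => exp (A + t • V)) 0 0 := by
    have := (hd (A + (0 : ℝ) • V)).comp_hasDerivAt (0 : ℝ) hline
    simpa [h, Function.comp_def] using this
  have hcomm : V * exp A = exp A * V := by
    have h1 := hline.mul hexp
    have h2 := hexp.mul hline
    have h3 : ((fun t : ℝ => A + t • V) * fun t : ℝ => exp (A + t • V)) =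
        (fun t : ℝ => exp (A + t • V)) * fun t : ℝ => A + t • V := by
      funext t
      exact ((Commute.refl (A + t • V)).exp_right).eq
    rw [h3] at h1
    simpa using h1.unique h2
  have hcA : Commute A V := by
    have h1 : Commute (exp A) V := hcomm.symm
    have h2 : Commute (matLog (exp A)) V :=
      h1.cfc (by
        have : star (exp A) = exp A := (exp_posDef hA).isHermitian
        rw [this]; exact h1) Real.log
    rwa [matLog_exp hA] at h2
  have hexp' : HasDerivAt (fun t : ℝ => exp (A + t • V)) (exp A * V) 0 := by
    have h1 : (fun t : ℝ => exp (A + t • V)) = fun t : ℝ => exp A * exp (t • V) := by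
      funext t
      exact Matrix.exp_add_of_commute _ _ (hcA.smul_right t)
    rw [h1]
    have := (hasDerivAt_exp_smul_const V (0 : ℝ)).const_mul (exp A)
    simpa using this
  have h0 : exp A * V = 0 := hexp'.unique hexp
  exact (Matrix.isUnit_exp A).mul_right_eq_zero.1 h0

theorem matLog_conj_orthogonal {O S : Mat n} (hO : O * Oᵀ = 1) (hS : S.PosDef) :
    matLog (O * S * Oᵀ) = O * matLog S * Oᵀ := by
  have hinv : O⁻¹ = Oᵀ := Matrix.inv_eq_right_inv hO
  have hu : IsUnit O := (Matrix.isUnit_iff_isUnit_det _).2 (Matrix.isUnit_det_of_right_inverse hO)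
  have hs : (O * matLog S * Oᵀ).IsSymm := by
    rw [Matrix.IsSymm, transpose_mul, transpose_mul, transpose_transpose, (matLog_isSymm S).eq,
      mul_assoc]
  rw [← matLog_exp hs, ← hinv, Matrix.exp_conj _ _ hu, exp_matLog hS]

end ExpLog

/-- Transposition as a continuous linear map. -/
def transposeL (n : ℕ) : Mat n →L[ℝ] Mat n :=
  LinearMap.toContinuousLinearMap (Matrix.transposeLinearEquiv (Fin n) (Fin n) ℝ ℝ).toLinearMap

/-! ### Derivatives along curves and second derivatives -/

section SecondDerivative

variable {E F : Type*} [NormedAddCommGroup E] [NormedSpace ℝ E] [NormedAddCommGroup F]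
  [NormedSpace ℝ F]

/-- The second derivative of `f` at `x` as a bilinear function. -/
def sndFDeriv (f : E → F) (x u v : E) : F := fderiv ℝ (fderiv ℝ f) x u v

theorem sndFDeriv_comm {f : E → F} {x : E} (hf : ContDiffAt ℝ 2 f x) (u v : E) :
    sndFDeriv f x u v = sndFDeriv f x v u :=
  (hf.isSymmSndFDerivAt (by simp) : IsSymmSndFDerivAt ℝ f x) u v

/-- In a flat chart f this derivative is the image under Df of the covariant derivative of X along
γ. -/
theorem hasDerivWithinAt_fderiv_apply {f : E → F} {γ X : ℝ → E} {t : ℝ} {v X' : E} {s : Set ℝ}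
    (hf : ContDiffAt ℝ 2 f (γ t)) (hγ : HasDerivWithinAt γ v s t)
    (hX : HasDerivWithinAt X X' s t) :
    HasDerivWithinAt (fun t => fderiv ℝ f (γ t) (X t))
      (sndFDeriv f (γ t) v (X t) + fderiv ℝ f (γ t) X') s t :=
  have h : HasFDerivAt (fderiv ℝ f) (fderiv ℝ (fderiv ℝ f) (γ t)) (γ t) :=
    ((hf.fderiv_right (m := 1) (by norm_num)).differentiableAt one_ne_zero).hasFDerivAt
  (h.comp_hasDerivWithinAt t hγ).clm_apply hX

theorem hasDerivAt_affine (a b : E) (t : ℝ) : HasDerivAt (fun t : ℝ => a + t • b) b t := by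
  simpa using ((hasDerivAt_id t).smul_const b).const_add a

theorem hasDerivAt_comp_affine {f : E → F} (a b : E) {t : ℝ}
    (hf : DifferentiableAt ℝ f (a + t • b)) :
    HasDerivAt (fun t : ℝ => f (a + t • b)) (fderiv ℝ f (a + t • b) b) t :=
  hf.hasFDerivAt.comp_hasDerivAt t (hasDerivAt_affine a b t)

theorem hasDerivAt_form_fderiv {f : E → F} {x : E} (hf : ContDiffAt ℝ 2 f x)
    (B : F →L[ℝ] F →L[ℝ] ℝ) (u v w : E) :
    HasDerivAt (fun t : ℝ => B (fderiv ℝ f (x + t • u) v) (fderiv ℝ f (x + t • u) w))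
      (B (sndFDeriv f x u v) (fderiv ℝ f x w) + B (fderiv ℝ f x v) (sndFDeriv f x u w)) 0 := by
  have h (v : E) : HasDerivAt (fun t : ℝ => fderiv ℝ f (x + t • u) v) (sndFDeriv f x u v) 0 := by
    have := hasDerivWithinAt_fderiv_apply (f := f) (γ := fun t : ℝ => x + t • u) (t := 0)
      (by simpa using hf) (hasDerivAt_affine x u 0).hasDerivWithinAt
      (hasDerivWithinAt_const (0 : ℝ) univ v)
    simpa using this
  have := (B.hasFDerivAt.comp_hasDerivAt (0 : ℝ) (h v)).clm_apply (h w)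
  simpa using this

theorem eq_of_hasDerivWithinAt_zero {f : ℝ → F}
    (hf : ∀ t ∈ Icc (0 : ℝ) 1, HasDerivWithinAt f 0 (Icc 0 1) t) {t : ℝ}
    (ht : t ∈ Icc (0 : ℝ) 1) : f t = f 0 := by
  refine constant_of_has_deriv_right_zero (fun s hs => (hf s hs).continuousWithinAt)
    (fun s hs => ?_) t ht
  exact (hf s ⟨hs.1, hs.2.le⟩).mono_of_mem_nhdsWithin (Icc_mem_nhdsGE_of_mem hs)

theorem add_of_hasDerivWithinAt_const {f : ℝ → F} {b : F}
    (hf : ∀ t ∈ Icc (0 : ℝ) 1, HasDerivWithinAt f b (Icc 0 1) t) : f 1 = f 0 + b := by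
  have key := eq_of_hasDerivWithinAt_zero (f := f - fun t : ℝ => t • b) (t := 1) (fun t ht => by
    simpa using (hf t ht).sub ((hasDerivAt_id t).smul_const b).hasDerivWithinAt)
    ⟨zero_le_one, le_rfl⟩
  simp only [Pi.sub_apply, one_smul, zero_smul, sub_zero] at key
  rw [← key, sub_add_cancel]

end SecondDerivative

theorem hasDerivWithinAt_transpose {X : ℝ → Mat n} {X' : Mat n} {t : ℝ} {s : Set ℝ}
    (hX : HasDerivWithinAt X X' s t) : HasDerivWithinAt (fun t => (X t)ᵀ) X'ᵀ s t :=
  (transposeL n).hasFDerivAt.comp_hasDerivWithinAt t hX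

/-- Transposition is linear and derivatives within [0,1] are unique. This makes X' a tangent vector,
as `FlatChart.metric_eq` requires. -/
theorem isSymm_of_hasDerivWithinAt {X : ℝ → Mat n} {X' : Mat n} {t : ℝ}
    (ht : t ∈ Icc (0 : ℝ) 1) (hX : HasDerivWithinAt X X' (Icc 0 1) t)
    (hs : ∀ t ∈ Icc (0 : ℝ) 1, (X t).IsSymm) : X'.IsSymm :=
  (uniqueDiffOn_Icc zero_lt_one t ht).eq_deriv _ (hasDerivWithinAt_transpose hX)
    (hX.congr (fun s hs' => hs s hs') (hs t ht))

theorem isSymm_fderiv_of_isSymm {F : Type*} [NormedAddCommGroup F] [NormedSpace ℝ F]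
    {f : F → Mat n} (hf : Differentiable ℝ f)
    (hs : ∀ y, (f y).IsSymm) (y b : F) : (fderiv ℝ f y b).IsSymm := by
  refine isSymm_of_hasDerivWithinAt (X := fun t : ℝ => f (y + t • b)) (t := 0)
    ⟨le_rfl, zero_le_one⟩ ?_ fun t _ => hs _
  simpa using (hasDerivAt_comp_affine (t := 0) y b (hf _)).hasDerivWithinAt

/-! ### Metrics that are constant in a global chart -/

section FlatChart

/-- A global `C²` chart of `Sym_n⁺` with values in a vector space. The chart is defined on an open
set of matrices around `Sym_n⁺`. -/
structure SPDChart (n : ℕ) (F : Type*) [NormedAddCommGroup F] [NormedSpace ℝ F] where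
  toFun : Mat n → F
  invFun : F → Mat n
  contDiffAt_toFun : ∀ P : Mat n, P.PosDef → ContDiffAt ℝ 2 toFun P
  contDiff_invFun : ContDiff ℝ 2 invFun
  posDef_invFun : ∀ y, (invFun y).PosDef
  right_inv : ∀ y, toFun (invFun y) = y
  left_inv : ∀ P : Mat n, P.PosDef → invFun (toFun P) = P
  posDef_nhds : ∀ P : Mat n, P.PosDef → ∀ᶠ X in 𝓝 P, X.IsSymm → X.PosDef

/-- A global chart of `Sym_n⁺` with values in a vector space in which the metric tensor `g` is a
constant positive definite bilinear form. -/
structure FlatChart (g : MetricTensor n) (F : Type*) [NormedAddCommGroup F] [NormedSpace ℝ F]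
    extends SPDChart n F where
  form : F →L[ℝ] F →L[ℝ] ℝ
  form_symm : ∀ x y, form x y = form y x
  form_self : ∀ x, form x x = 0 → x = 0
  metric_eq : ∀ P V W : Mat n, P.PosDef → V.IsSymm → W.IsSymm →
    g P V W = form (fderiv ℝ toFun P V) (fderiv ℝ toFun P W)

namespace SPDChart

variable {F : Type*} [NormedAddCommGroup F] [NormedSpace ℝ F]

theorem hasFDerivAt_toFun (c : SPDChart n F) {P : Mat n} (hP : P.PosDef) :
    HasFDerivAt c.toFun (fderiv ℝ c.toFun P) P :=
  ((c.contDiffAt_toFun P hP).differentiableAt two_ne_zero).hasFDerivAt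

theorem hasFDerivAt_invFun (c : SPDChart n F) (y : F) :
    HasFDerivAt c.invFun (fderiv ℝ c.invFun y) y :=
  (c.contDiff_invFun.differentiable two_ne_zero y).hasFDerivAt

/-- Line derivatives in symmetric directions thus only see positive definite matrices, where the
metric and chart identities hold. -/
theorem eventually_posDef_line (c : SPDChart n F) {P U : Mat n} (hP : P.PosDef) (hU : U.IsSymm) :
    ∀ᶠ t : ℝ in 𝓝 0, (P + t • U).PosDef := by
  have h : Tendsto (fun t : ℝ => P + t • U) (𝓝 0) (𝓝 P) := by
    simpa using (hasDerivAt_affine P U 0).continuousAt.tendsto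
  filter_upwards [h.eventually (c.posDef_nhds P hP)] with t ht
  exact ht ((isSymm_of_posDef hP).add (hU.smul t))

theorem isSymm_fderiv_invFun (c : SPDChart n F) (y b : F) : (fderiv ℝ c.invFun y b).IsSymm :=
  isSymm_fderiv_of_isSymm (c.contDiff_invFun.differentiable two_ne_zero)
    (fun y => isSymm_of_posDef (c.posDef_invFun y)) y b

theorem fderiv_toFun_fderiv_invFun (c : SPDChart n F) (y b : F) :
    fderiv ℝ c.toFun (c.invFun y) (fderiv ℝ c.invFun y b) = b := by
  have h := (c.hasFDerivAt_toFun (c.posDef_invFun y)).comp y (c.hasFDerivAt_invFun y)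
  have h2 : c.toFun ∘ c.invFun = id := funext c.right_inv
  rw [h2] at h
  exact congrArg (fun L : F →L[ℝ] F => L b) (h.unique (hasFDerivAt_id y))

theorem fderiv_invFun_fderiv_toFun (c : SPDChart n F) {P V : Mat n} (hP : P.PosDef)
    (hV : V.IsSymm) :
    fderiv ℝ c.invFun (c.toFun P) (fderiv ℝ c.toFun P V) = V := by
  have h0 := hasDerivAt_affine P V 0
  have h1 : HasFDerivAt c.toFun (fderiv ℝ c.toFun P) (P + (0 : ℝ) • V) := by
    simpa using c.hasFDerivAt_toFun hP
  have h2 := h1.comp_hasDerivAt (0 : ℝ) h0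
  have h3 : HasFDerivAt c.invFun (fderiv ℝ c.invFun (c.toFun P)) (c.toFun (P + (0 : ℝ) • V)) := by
    simpa using c.hasFDerivAt_invFun (c.toFun P)
  have h4 := h3.comp_hasDerivAt (0 : ℝ) h2
  refine h4.unique (h0.congr_of_eventuallyEq ?_)
  filter_upwards [c.eventually_posDef_line hP hV] with t ht
  exact c.left_inv _ ht

theorem exists_isSymm_fderiv_toFun_eq (c : SPDChart n F) {P : Mat n} (hP : P.PosDef) (b : F) :
    ∃ V : Mat n, V.IsSymm ∧ fderiv ℝ c.toFun P V = b := by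
  refine ⟨fderiv ℝ c.invFun (c.toFun P) b, c.isSymm_fderiv_invFun _ _, ?_⟩
  conv_lhs => rw [← c.left_inv P hP, c.right_inv]
  exact c.fderiv_toFun_fderiv_invFun _ b

end SPDChart

namespace FlatChart

variable {g : MetricTensor n} {F : Type*} [NormedAddCommGroup F] [NormedSpace ℝ F]

theorem lineDeriv_metric (c : FlatChart g F) {P U V W : Mat n} (hP : P.PosDef) (hU : U.IsSymm)
    (hV : V.IsSymm) (hW : W.IsSymm) : lineDeriv ℝ (fun X : Mat n => g X V W) P U =
      c.form (sndFDeriv c.toFun P U V) (fderiv ℝ c.toFun P W) +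
        c.form (fderiv ℝ c.toFun P V) (sndFDeriv c.toFun P U W) := by
  refine HasDerivAt.deriv ?_
  refine (hasDerivAt_form_fderiv (c.contDiffAt_toFun P hP) c.form U V W).congr_of_eventuallyEq ?_
  filter_upwards [c.eventually_posDef_line hP hU] with t ht
  exact c.metric_eq _ V W ht hV hW

/-- Koszul's formula yields six terms; by symmetry of the second derivative and of the form, four
cancel and the other two agree. -/
theorem christoffel_eq (c : FlatChart g F) {P U V W : Mat n} (hP : P.PosDef) (hU : U.IsSymm)
    (hV : V.IsSymm) (hW : W.IsSymm) : christoffel g P U V W =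
      c.form (sndFDeriv c.toFun P U V) (fderiv ℝ c.toFun P W) := by
  have hs := sndFDeriv_comm (c.contDiffAt_toFun P hP)
  rw [christoffel, c.lineDeriv_metric hP hU hV hW, c.lineDeriv_metric hP hV hU hW,
    c.lineDeriv_metric hP hW hU hV, hs V U, hs W U, hs W V,
    c.form_symm (sndFDeriv c.toFun P U W)]
  ring

theorem metric_add_christoffel (c : FlatChart g F) {P v X X' W : Mat n}
    (hP : P.PosDef) (hv : v.IsSymm)
    (hX : X.IsSymm) (hX' : X'.IsSymm) (hW : W.IsSymm) :
    g P X' W + christoffel g P v X W =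
      c.form (sndFDeriv c.toFun P v X + fderiv ℝ c.toFun P X')
        (fderiv ℝ c.toFun P W) := by
  rw [c.metric_eq _ _ _ hP hX' hW, c.christoffel_eq hP hv hX hW, map_add,
    _root_.add_apply, add_comm]

/-- Parallelism says that the derivative of Dφ(X) is orthogonal to every Dφ(W), and these fill the
whole model space. -/
theorem fderiv_toFun_eq_of_isParallelAlong (c : FlatChart g F) {γ v X : ℝ → Mat n}
    (hγ : IsCurve γ v)
    (hv : ∀ t ∈ Icc (0 : ℝ) 1, (v t).IsSymm) (hX : IsParallelAlong g γ v X) {t : ℝ}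
    (ht : t ∈ Icc (0 : ℝ) 1) :
    fderiv ℝ c.toFun (γ t) (X t) = fderiv ℝ c.toFun (γ 0) (X 0) := by
  refine eq_of_hasDerivWithinAt_zero (f := fun t => fderiv ℝ c.toFun (γ t) (X t))
    (fun s hs => ?_) ht
  obtain ⟨hP, hd⟩ := hγ s hs
  obtain ⟨hXs, X', hX', hW⟩ := hX s hs
  have hsX' := isSymm_of_hasDerivWithinAt hs hX' fun r hr => (hX r hr).1
  have h := hasDerivWithinAt_fderiv_apply (c.contDiffAt_toFun _ hP) hd hX'
  have h0 : sndFDeriv c.toFun (γ s) (v s) (X s) + fderiv ℝ c.toFun (γ s) X' = 0 := by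
    -- Test against the tangent vector whose image is the derivative itself; definiteness of the
    -- form then kills it.
    obtain ⟨W, hWs, hWe⟩ := c.exists_isSymm_fderiv_toFun_eq hP
      (sndFDeriv c.toFun (γ s) (v s) (X s) + fderiv ℝ c.toFun (γ s) X')
    have := hW W hWs
    rw [c.metric_add_christoffel hP (hv s hs) hXs hsX' hWs, hWe] at this
    exact c.form_self _ this
  rwa [h0] at h

theorem toFun_eq_of_isGeodesic (c : FlatChart g F) {γ v : ℝ → Mat n} (h : IsGeodesic g γ v) :
    c.toFun (γ 1) = c.toFun (γ 0) + fderiv ℝ c.toFun (γ 0) (v 0) := by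
  refine add_of_hasDerivWithinAt_const (f := fun t => c.toFun (γ t)) fun t ht => ?_
  rw [← c.fderiv_toFun_eq_of_isParallelAlong h.1 (fun s hs => (h.2 s hs).1) h.2 ht]
  exact (c.hasFDerivAt_toFun (h.1 t ht).1).comp_hasDerivWithinAt t (h.1 t ht).2

theorem isCurve_invFun_line (c : FlatChart g F) (a b : F) :
    IsCurve (fun t => c.invFun (a + t • b)) (fun t => fderiv ℝ c.invFun (a + t • b) b) :=
  fun t _ => ⟨c.posDef_invFun _, ((c.hasFDerivAt_invFun _).comp_hasDerivAt t
    (hasDerivAt_affine a b t)).hasDerivWithinAt⟩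

/-- Supplies the witnesses for the `Classical.epsilon` choices: Dφ sends this field to the constant
x, and differentiating that identity gives a vanishing covariant derivative. -/
theorem isParallelAlong_invFun_line (c : FlatChart g F) (a b x : F) :
    IsParallelAlong g (fun t => c.invFun (a + t • b)) (fun t => fderiv ℝ c.invFun (a + t • b) b)
      (fun t => fderiv ℝ c.invFun (a + t • b) x) := by
  intro t ht
  have hX : HasDerivWithinAt (fun t : ℝ => fderiv ℝ c.invFun (a + t • b) x)
      (sndFDeriv c.invFun (a + t • b) b x) (Icc 0 1) t := by
    simpa using hasDerivWithinAt_fderiv_apply c.contDiff_invFun.contDiffAt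
      (hasDerivAt_affine a b t).hasDerivWithinAt (hasDerivWithinAt_const t _ x)
  refine ⟨c.isSymm_fderiv_invFun _ _, _, hX, fun W hW => ?_⟩
  have hsX := isSymm_of_hasDerivWithinAt ht hX fun r _ => c.isSymm_fderiv_invFun _ _
  obtain ⟨hP, hd⟩ := c.isCurve_invFun_line a b t ht
  have h := hasDerivWithinAt_fderiv_apply (c.contDiffAt_toFun _ hP) hd hX
  simp only [c.fderiv_toFun_fderiv_invFun] at h
  have h0 := (uniqueDiffOn_Icc zero_lt_one t ht).eq_deriv _ h (hasDerivWithinAt_const t _ x)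
  rw [c.metric_add_christoffel hP (c.isSymm_fderiv_invFun _ _) (c.isSymm_fderiv_invFun _ _) hsX hW,
    h0]
  simp

theorem isGeodesic_invFun_line (c : FlatChart g F) (a b : F) :
    IsGeodesic g (fun t => c.invFun (a + t • b)) (fun t => fderiv ℝ c.invFun (a + t • b) b) :=
  ⟨c.isCurve_invFun_line a b, c.isParallelAlong_invFun_line a b b⟩

theorem toFun_injective (c : FlatChart g F) {P Q : SPD n}
    (h : c.toFun P.1 = c.toFun Q.1) : P = Q := by
  apply Subtype.ext
  rw [← c.left_inv _ P.2, h, c.left_inv _ Q.2]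

theorem toFun_riemExp (c : FlatChart g F) (P : SPD n) {V : Mat n} (hV : V.IsSymm) :
    c.toFun (riemExp g P V).1 = c.toFun P.1 + fderiv ℝ c.toFun P.1 V := by
  have hex : ∃ Q : SPD n, ∃ γ v, IsGeodesic g γ v ∧ γ 0 = P.1 ∧ v 0 = V ∧ γ 1 = Q.1 := by
    refine ⟨⟨_, c.posDef_invFun (c.toFun P.1 + (1 : ℝ) • fderiv ℝ c.toFun P.1 V)⟩, _, _,
      c.isGeodesic_invFun_line (c.toFun P.1) (fderiv ℝ c.toFun P.1 V), ?_, ?_, rfl⟩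
    · simpa using c.left_inv _ P.2
    · simpa using c.fderiv_invFun_fderiv_toFun P.2 hV
  obtain ⟨γ, v, hγ, h0, hv, h1⟩ := Classical.epsilon_spec hex
  have h := c.toFun_eq_of_isGeodesic hγ
  rw [h0, hv, h1] at h
  exact h

/-- The two properties determine the chosen vector. Its symmetry comes from the velocity being a
parallel field. -/
theorem riemLog_spec (c : FlatChart g F) (P Q : SPD n) : (riemLog g P Q).IsSymm ∧
    fderiv ℝ c.toFun P.1 (riemLog g P Q) = c.toFun Q.1 - c.toFun P.1 := by
  have hex : ∃ V : Mat n, ∃ γ v, IsGeodesic g γ v ∧ γ 0 = P.1 ∧ γ 1 = Q.1 ∧ v 0 = V := by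
    refine ⟨_, _, _, c.isGeodesic_invFun_line (c.toFun P.1) (c.toFun Q.1 - c.toFun P.1), ?_, ?_,
      rfl⟩
    · simpa using c.left_inv _ P.2
    · simpa using c.left_inv _ Q.2
  obtain ⟨γ, v, hγ, h0, h1, hv⟩ := Classical.epsilon_spec hex
  have h := c.toFun_eq_of_isGeodesic hγ
  have hs := (hγ.2 0 ⟨le_rfl, zero_le_one⟩).1
  rw [h0, h1, hv] at h
  rw [hv] at hs
  exact ⟨hs, by rw [riemLog, h]; abel⟩

theorem transport_spec (c : FlatChart g F) (P Q : SPD n) {V : Mat n} (hV : V.IsSymm) :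
    (transport g P Q V).IsSymm ∧
    fderiv ℝ c.toFun Q.1 (transport g P Q V) = fderiv ℝ c.toFun P.1 V := by
  have hex : ∃ W : Mat n, ∃ γ v X, IsGeodesic g γ v ∧ γ 0 = P.1 ∧ γ 1 = Q.1 ∧
      IsParallelAlong g γ v X ∧ X 0 = V ∧ X 1 = W := by
    refine ⟨_, _, _, _, c.isGeodesic_invFun_line (c.toFun P.1) (c.toFun Q.1 - c.toFun P.1), ?_, ?_,
      c.isParallelAlong_invFun_line _ _ (fderiv ℝ c.toFun P.1 V), ?_, rfl⟩
    · simpa using c.left_inv _ P.2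
    · simpa using c.left_inv _ Q.2
    · simpa using c.fderiv_invFun_fderiv_toFun P.2 hV
  obtain ⟨γ, v, X, hγ, h0, h1, hX, hX0, hX1⟩ := Classical.epsilon_spec hex
  have h2 : (1 : ℝ) ∈ Icc (0 : ℝ) 1 := ⟨zero_le_one, le_rfl⟩
  have h := c.fderiv_toFun_eq_of_isParallelAlong hγ.1 (fun s hs => (hγ.2 s hs).1) hX h2
  have hs := (hX 1 h2).1
  rw [h0, h1, hX0, hX1] at h
  rw [hX1] at hs
  exact ⟨hs, h⟩

theorem toFun_gyroAdd (c : FlatChart g F) (P Q : SPD n) :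
    c.toFun (gyroAdd g P Q).1 = c.toFun P.1 + (c.toFun Q.1 - c.toFun 1) := by
  obtain ⟨h1, h2⟩ := c.riemLog_spec (SPD.one n) Q
  obtain ⟨h3, h4⟩ := c.transport_spec (SPD.one n) P h1
  rw [gyroAdd, c.toFun_riemExp P h3, h4, h2]
  rfl

theorem toFun_gyroNeg (c : FlatChart g F) (P : SPD n) :
    c.toFun (gyroNeg g P).1 = c.toFun 1 - (c.toFun P.1 - c.toFun 1) := by
  have hex : ∃ N : SPD n, gyroAdd g N P = SPD.one n := by
    refine ⟨⟨_, c.posDef_invFun (c.toFun 1 - (c.toFun P.1 - c.toFun 1))⟩, c.toFun_injective ?_⟩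
    rw [c.toFun_gyroAdd, c.right_inv, sub_add_cancel]
    rfl
  have h := congrArg (fun Q : SPD n => c.toFun Q.1) (Classical.epsilon_spec hex)
  simp only [c.toFun_gyroAdd] at h
  exact eq_sub_of_add_eq h

theorem gyroDist_eq (c : FlatChart g F) (P Q : SPD n) :
    gyroDist g P Q = √(c.form (c.toFun Q.1 - c.toFun P.1) (c.toFun Q.1 - c.toFun P.1)) := by
  obtain ⟨h1, h2⟩ := c.riemLog_spec (SPD.one n) (gyroAdd g (gyroNeg g P) Q)
  have h3 : fderiv ℝ c.toFun 1 (riemLog g (SPD.one n) (gyroAdd g (gyroNeg g P) Q)) =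
      c.toFun Q.1 - c.toFun P.1 := by
    refine h2.trans ?_
    rw [c.toFun_gyroAdd, c.toFun_gyroNeg]
    change _ - c.toFun 1 = _
    abel
  rw [gyroDist, spdNorm, spdInner, c.metric_eq _ _ _ Matrix.PosDef.one h1 h1, h3]

theorem isGyroisometry_leftGyrotranslation (c : FlatChart g F) (P : SPD n) :
    IsGyroisometry g (leftGyrotranslation g P) := by
  intro Q R
  rw [leftGyrotranslation, leftGyrotranslation, c.gyroDist_eq, c.gyroDist_eq, c.toFun_gyroAdd,
    c.toFun_gyroAdd, add_sub_add_left_eq_sub, sub_sub_sub_cancel_right]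

end FlatChart

end FlatChart

/-! ### Charts obtained by inverting a parametrization -/

section OfInjective

/-- The space `Sym_n` of real symmetric matrices. -/
def symSubmodule (n : ℕ) : Submodule ℝ (Mat n) where
  carrier := {V | V.IsSymm}
  add_mem' ha hb := ha.add hb
  zero_mem' := Matrix.isSymm_zero
  smul_mem' r _ hV := hV.smul r

/-- The symmetric part of a matrix. -/
def symPart (n : ℕ) : Mat n →L[ℝ] symSubmodule n :=
  LinearMap.toContinuousLinearMap
    { toFun := fun X => ⟨(2⁻¹ : ℝ) • (X + Xᵀ), by
        change ((2⁻¹ : ℝ) • (X + Xᵀ))ᵀ = _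
        rw [transpose_smul, transpose_add, transpose_transpose, add_comm]⟩
      map_add' := fun X Y => Subtype.ext (by
        change (2⁻¹ : ℝ) • (X + Y + (X + Y)ᵀ) = (2⁻¹ : ℝ) • (X + Xᵀ) + (2⁻¹ : ℝ) • (Y + Yᵀ)
        rw [transpose_add]; module)
      map_smul' := fun r X => Subtype.ext (by
        change (2⁻¹ : ℝ) • (r • X + (r • X)ᵀ) = r • (2⁻¹ : ℝ) • (X + Xᵀ)
        rw [transpose_smul]; module) }

theorem symPart_of_isSymm {X : Mat n} (hX : X.IsSymm) : symPart n X = ⟨X, hX⟩ := by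
  apply Subtype.ext
  change (2⁻¹ : ℝ) • (X + Xᵀ) = X
  rw [hX.eq]; module

theorem coe_symPart_of_isSymm {X : Mat n} (hX : X.IsSymm) : (symPart n X : Mat n) = X := by
  rw [symPart_of_isSymm hX]

variable {F : Type*} [NormedAddCommGroup F] [NormedSpace ℝ F]

/-- The inverse function theorem applies to `symPart` ∘ f, with values in the symmetric matrices; as
a map into all matrices, f need not have a surjective derivative. -/
theorem exists_contDiffAt_local_inverse [FiniteDimensional ℝ F] {f : F → Mat n}
    (hf : ContDiff ℝ 2 f) (hs : ∀ y, (f y).IsSymm) (y : F)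
    (hinj : ∀ b, fderiv ℝ f y b = 0 → b = 0)
    (hsurj : ∀ V : Mat n, V.IsSymm → ∃ b, fderiv ℝ f y b = V) :
    ∃ h : symSubmodule n → F, ContDiffAt ℝ 2 h (symPart n (f y)) ∧
      ∀ᶠ X in 𝓝 (symPart n (f y)), f (h X) = X := by
  have hcomplete : CompleteSpace F := FiniteDimensional.complete ℝ F
  have hfd : Differentiable ℝ f := hf.differentiable two_ne_zero
  have hS := isSymm_fderiv_of_isSymm hfd hs y
  have hbij : Function.Bijective ((symPart n).comp (fderiv ℝ f y)).toLinearMap := by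
    constructor
    · refine (injective_iff_map_eq_zero _).2 fun b hb => hinj b ?_
      have hb' : ((symPart n (fderiv ℝ f y b) : symSubmodule n) : Mat n) = 0 :=
        congrArg Subtype.val hb
      rwa [coe_symPart_of_isSymm (hS b)] at hb'
    · rintro ⟨V, hV⟩
      obtain ⟨b, hb⟩ := hsurj V hV
      refine ⟨b, Subtype.ext ?_⟩
      change ((symPart n (fderiv ℝ f y b) : symSubmodule n) : Mat n) = V
      rw [coe_symPart_of_isSymm (hS b), hb]
  let e : F ≃L[ℝ] symSubmodule n := (LinearEquiv.ofBijective _ hbij).toContinuousLinearEquiv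
  have hg : ContDiffAt ℝ 2 (fun x => symPart n (f x)) y :=
    ((symPart n).contDiff.comp hf).contDiffAt
  have hg' : HasFDerivAt (fun x => symPart n (f x)) (e : F →L[ℝ] symSubmodule n) y :=
    (symPart n).hasFDerivAt.comp y (hfd y).hasFDerivAt
  refine ⟨_, hg.to_localInverse hg' two_ne_zero, ?_⟩
  filter_upwards [(hg.hasStrictFDerivAt' hg' two_ne_zero).eventually_right_inverse] with X hX
  conv_rhs => rw [← hX]
  rw [coe_symPart_of_isSymm (hs _)]
  rfl

/-- A chart of `Sym_n⁺` from the inverse of the chart. -/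
def SPDChart.ofInverse [FiniteDimensional ℝ F] (f : F → Mat n) (φ : Mat n → F)
    (hf : ContDiff ℝ 2 f) (hpos : ∀ y, (f y).PosDef)
    (hinj : ∀ y b, fderiv ℝ f y b = 0 → b = 0)
    (hsurj : ∀ y (V : Mat n), V.IsSymm → ∃ b, fderiv ℝ f y b = V)
    (hr : ∀ y, φ (f y) = y) (hl : ∀ P : Mat n, P.PosDef → f (φ P) = P) : SPDChart n F where
  toFun X := φ (symPart n X)
  invFun := f
  contDiffAt_toFun P hP := by
    have hs := fun y => isSymm_of_posDef (hpos y)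
    obtain ⟨h, hh, hev⟩ := exists_contDiffAt_local_inverse hf hs (φ P) (hinj _) (hsurj _)
    rw [hl P hP] at hh hev
    refine (hh.comp P (symPart n).contDiff.contDiffAt).congr_of_eventuallyEq ?_
    -- Near P the symmetric part of X equals f(h(·)) of itself, so φ agrees there with the smooth
    -- local inverse h.
    filter_upwards [(symPart n).continuous.continuousAt.eventually hev] with X hX
    change _ = h (symPart n X)
    rw [← hX, hr]
  contDiff_invFun := hf
  posDef_invFun := hpos
  right_inv y := by rw [coe_symPart_of_isSymm (isSymm_of_posDef (hpos y)), hr]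
  left_inv P hP := by rw [coe_symPart_of_isSymm (isSymm_of_posDef hP), hl P hP]
  posDef_nhds P hP := by
    have hs := fun y => isSymm_of_posDef (hpos y)
    obtain ⟨h, hh, hev⟩ := exists_contDiffAt_local_inverse hf hs (φ P) (hinj _) (hsurj _)
    rw [hl P hP] at hev
    -- A symmetric X near P lies in the range of f, which consists of positive definite matrices.
    filter_upwards [(symPart n).continuous.continuousAt.eventually hev] with X hX hXs
    rw [coe_symPart_of_isSymm hXs] at hX
    exact hX ▸ hpos _

end OfInjective

/-! ### The Frobenius form -/

section Frobenius

/-- The Frobenius inner product as a continuous bilinear form. -/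
def frobeniusL (n : ℕ) : Mat n →L[ℝ] Mat n →L[ℝ] ℝ :=
  LinearMap.toContinuousLinearMap (LinearMap.toContinuousLinearMap.toLinearMap ∘ₗ
    LinearMap.mk₂ ℝ frobenius
      (fun V V' W => by simp [frobenius, add_mul, Finset.sum_add_distrib])
      (fun r V W => by simp [frobenius, mul_assoc, Finset.mul_sum])
      (fun V W W' => by simp [frobenius, mul_add, Finset.sum_add_distrib])
      (fun r V W => by simp [frobenius, mul_left_comm, Finset.mul_sum]))

theorem frobenius_comm (V W : Mat n) : frobenius V W = frobenius W V := by
  simp only [frobenius, mul_comm]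

theorem eq_zero_of_frobenius_self {V : Mat n} (h : frobenius V V = 0) : V = 0 := by
  ext i j
  have h1 : ∀ i, 0 ≤ ∑ j, V i j * V i j := fun i =>
    Finset.sum_nonneg fun j _ => mul_self_nonneg _
  have h2 := (Finset.sum_eq_zero_iff_of_nonneg fun i _ => h1 i).1 h i (Finset.mem_univ i)
  have h3 := (Finset.sum_eq_zero_iff_of_nonneg fun j _ => mul_self_nonneg (V i j)).1 h2 j
    (Finset.mem_univ j)
  simpa using h3

/-- The Frobenius inner product on a space of matrices. -/
def frobeniusOn (S : Submodule ℝ (Mat n)) : S →L[ℝ] S →L[ℝ] ℝ :=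
  (frobeniusL n).bilinearComp S.subtypeL S.subtypeL

theorem frobeniusOn_apply (S : Submodule ℝ (Mat n)) (x y : S) :
    frobeniusOn S x y = frobenius (x : Mat n) y := rfl

end Frobenius

/-! ### The Log-Euclidean chart -/

section LogEuclidean

theorem fderiv_exp_subtype (y b : symSubmodule n) :
    fderiv ℝ (fun y : symSubmodule n => exp (y : Mat n)) y b = fderiv ℝ exp (y : Mat n) b := by
  have h : HasFDerivAt (exp : Mat n → Mat n) (fderiv ℝ exp (y : Mat n)) (y : Mat n) :=
    ((contDiff_exp_mat (k := 1)).differentiable one_ne_zero _).hasFDerivAt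
  have h2 := (h.comp y (symSubmodule n).subtypeL.hasFDerivAt).fderiv
  exact congrArg (fun L => L b) h2

/-- The matrix logarithm as a chart of `Sym_n⁺`. -/
def logChart (n : ℕ) : SPDChart n (symSubmodule n) :=
  have hd : ContDiff ℝ 2 fun y : symSubmodule n => exp (y : Mat n) :=
    contDiff_exp_mat.comp (symSubmodule n).subtypeL.contDiff
  have hpos : ∀ y : symSubmodule n, (exp (y : Mat n)).PosDef := fun y => exp_posDef y.2
  have hinj : ∀ y b : symSubmodule n,
      fderiv ℝ (fun y : symSubmodule n => exp (y : Mat n)) y b = 0 → b = 0 := fun y b h => by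
    rw [fderiv_exp_subtype] at h
    exact Subtype.ext (fderiv_exp_injective y.2 h)
  SPDChart.ofInverse (fun y => exp (y : Mat n)) (fun X => ⟨matLog X, matLog_isSymm X⟩)
    hd hpos hinj
    (fun y V hV => by
      have hs := isSymm_fderiv_of_isSymm (hd.differentiable two_ne_zero)
        (fun y => isSymm_of_posDef (hpos y)) y
      -- The differential is an endomorphism of a finite-dimensional space, so injectivity gives
      -- surjectivity.
      let T : symSubmodule n →ₗ[ℝ] symSubmodule n :=
        ((fderiv ℝ (fun y : symSubmodule n => exp (y : Mat n)) y).toLinearMap).codRestrict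
          (symSubmodule n) hs
      have hT : Function.Injective T := (injective_iff_map_eq_zero T).2 fun b hb =>
        hinj y b (congrArg Subtype.val hb)
      obtain ⟨b, hb⟩ := LinearMap.injective_iff_surjective.1 hT ⟨V, hV⟩
      exact ⟨b, congrArg Subtype.val hb⟩)
    (fun y => Subtype.ext (matLog_exp y.2)) (fun P hP => exp_matLog hP)

theorem logChart_toFun {P : Mat n} (hP : P.PosDef) :
    ((logChart n).toFun P : Mat n) = matLog P := by
  change matLog (symPart n P : Mat n) = matLog P
  rw [coe_symPart_of_isSymm (isSymm_of_posDef hP)]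

/-- The chart precomposes log with `symPart`, but the line through P along a symmetric V consists of
symmetric matrices, where the two functions agree. -/
theorem dMatLog_eq {P V : Mat n} (hP : P.PosDef) (hV : V.IsSymm) :
    dMatLog P V = (fderiv ℝ (logChart n).toFun P V : Mat n) := by
  ext i j
  let ev : symSubmodule n →L[ℝ] ℝ := LinearMap.toContinuousLinearMap
    ((Matrix.entryLinearMap ℝ ℝ i j).comp (symSubmodule n).subtype)
  have h1 := hasDerivAt_comp_affine (t := 0) P V (f := (logChart n).toFun)
    (by simpa using ((logChart n).hasFDerivAt_toFun hP).differentiableAt)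
  have h2 := ev.hasFDerivAt.comp_hasDerivAt (0 : ℝ) h1
  rw [zero_smul, add_zero] at h2
  refine (h2.congr_of_eventuallyEq ?_).deriv
  filter_upwards [(logChart n).eventually_posDef_line hP hV] with t ht
  exact congrArg (fun M : Mat n => M i j) (logChart_toFun ht).symm

/-- The matrix logarithm is a flat chart for the Log-Euclidean metric. -/
def leChart (n : ℕ) : FlatChart (leMetric n) (symSubmodule n) where
  toSPDChart := logChart n
  form := frobeniusOn (symSubmodule n)
  form_symm x y := frobenius_comm _ _
  form_self x h := Subtype.ext (eq_zero_of_frobenius_self h)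
  metric_eq P V W hP hV hW := by
    rw [frobeniusOn_apply, ← dMatLog_eq hP hV, ← dMatLog_eq hP hW, leMetric]

end LogEuclidean

/-! ### The Cholesky factor and its differential -/

section Cholesky

/-- The space of lower triangular matrices. -/
def lowerSubmodule (n : ℕ) : Submodule ℝ (Mat n) where
  carrier := {L | ∀ i j, i < j → L i j = 0}
  add_mem' ha hb i j hij := by simp [ha i j hij, hb i j hij]
  zero_mem' _ _ _ := rfl
  smul_mem' _ _ hV i j hij := by simp [hV i j hij]

theorem mem_lowerSubmodule_iff {L : Mat n} :
    L ∈ lowerSubmodule n ↔ L.BlockTriangular OrderDual.toDual :=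
  ⟨fun h _ _ hij => h _ _ hij, fun h _ _ hij => h hij⟩

theorem mul_mem_lowerSubmodule {L M : Mat n} (hL : L ∈ lowerSubmodule n)
    (hM : M ∈ lowerSubmodule n) : L * M ∈ lowerSubmodule n :=
  mem_lowerSubmodule_iff.2 ((mem_lowerSubmodule_iff.1 hL).mul (mem_lowerSubmodule_iff.1 hM))

theorem inv_mem_lowerSubmodule {L : Mat n} (hL : L ∈ lowerSubmodule n) (hu : IsUnit L.det) :
    L⁻¹ ∈ lowerSubmodule n := by
  have : Invertible L := L.invertibleOfIsUnitDet hu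
  exact mem_lowerSubmodule_iff.2
    (Matrix.blockTriangular_inv_of_blockTriangular (mem_lowerSubmodule_iff.1 hL))

theorem det_eq_prod_of_mem_lowerSubmodule {L : Mat n} (hL : L ∈ lowerSubmodule n) :
    L.det = ∏ i, L i i :=
  Matrix.det_of_isLowerTriangular L (mem_lowerSubmodule_iff.1 hL)

theorem isUnit_det_of_lower {L : Mat n} (hL : L ∈ lowerSubmodule n) (hd : ∀ i, 0 < L i i) :
    IsUnit L.det := by
  rw [det_eq_prod_of_mem_lowerSubmodule hL]
  exact (Finset.prod_pos fun i _ => hd i).ne'.isUnit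

theorem mul_apply_diag_of_lower {L M : Mat n} (hL : L ∈ lowerSubmodule n)
    (hM : M ∈ lowerSubmodule n) (i : Fin n) : (L * M) i i = L i i * M i i := by
  rw [Matrix.mul_apply]
  refine Finset.sum_eq_single i (fun j _ hj => ?_) fun h => (h (Finset.mem_univ i)).elim
  rcases lt_or_gt_of_ne hj with h | h
  · rw [hM j i h, mul_zero]
  · rw [hL i j h, zero_mul]

theorem IsCholeskyFactor.isUnit_det {P L : Mat n} (h : IsCholeskyFactor P L) : IsUnit L.det :=
  isUnit_det_of_lower h.lower h.diag_pos

/-- N = M⁻¹L is lower triangular and orthogonal, so Nᵀ = N⁻¹ is lower triangular too. Thus N is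
diagonal with N_ii² = 1, and positivity of the diagonals forces N = 1. -/
theorem IsCholeskyFactor.unique {P L M : Mat n} (hL : IsCholeskyFactor P L)
    (hM : IsCholeskyFactor P M) : L = M := by
  have hMu := hM.isUnit_det
  have hN : M⁻¹ * L ∈ lowerSubmodule n :=
    mul_mem_lowerSubmodule (inv_mem_lowerSubmodule hM.lower hMu) hL.lower
  have hLN : L = M * (M⁻¹ * L) := (Matrix.mul_nonsing_inv_cancel_left _ _ hMu).symm
  generalize M⁻¹ * L = N at hN hLN
  have hNN : N * Nᵀ = 1 := by
    have h1 : M * (N * Nᵀ) * Mᵀ = M * 1 * Mᵀ := by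
      have : (M * N) * (M * N)ᵀ = M * Mᵀ := by
        rw [← hLN, hL.mul_transpose, hM.mul_transpose]
      rw [transpose_mul] at this
      simpa only [mul_assoc, mul_one, one_mul] using this
    have hu : IsUnit M := (Matrix.isUnit_iff_isUnit_det M).2 hMu
    have hut : IsUnit Mᵀ := (Matrix.isUnit_transpose M).2 hu
    exact hu.mul_left_cancel (hut.mul_right_cancel h1)
  have hNt : Nᵀ ∈ lowerSubmodule n := by
    rw [← Matrix.inv_eq_right_inv hNN]
    exact inv_mem_lowerSubmodule hN (Matrix.isUnit_det_of_right_inverse hNN)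
  have hN1 : N = 1 := by
    ext i j
    rcases lt_trichotomy i j with h | rfl | h
    · rw [hN i j h, Matrix.one_apply_ne h.ne]
    · have h1 := mul_apply_diag_of_lower hN hNt i
      rw [hNN, Matrix.one_apply_eq, Matrix.transpose_apply] at h1
      have h2 := mul_apply_diag_of_lower hM.lower hN i
      rw [← hLN] at h2
      have h3 : 0 < N i i := by
        have := hL.diag_pos i
        rw [h2] at this
        exact pos_of_mul_pos_right this (hM.diag_pos i).le
      rw [Matrix.one_apply_eq]
      nlinarith
    · rw [Matrix.one_apply_ne h.ne']
      exact hNt j i h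
  rw [hLN, hN1, mul_one]

/-- Rescale the columns of the lower factor in the LDL decomposition by the square roots of the
diagonal entries. -/
theorem exists_isCholeskyFactor {P : Mat n} (hP : P.PosDef) : ∃ L, IsCholeskyFactor P L := by
  set A := LDL.lowerInv hP with hA
  have hAl : A ∈ lowerSubmodule n := fun i j hij => LDL.lowerInv_triangular hP hij
  have hAu : IsUnit A.det := (Matrix.isUnit_iff_isUnit_det _).1 (isUnit_of_invertible A)
  have hAi := inv_mem_lowerSubmodule hAl hAu
  have hAd : ∀ i, A⁻¹ i i ≠ 0 := by
    have h : (A⁻¹).det ≠ 0 := (Matrix.isUnit_nonsing_inv_det A hAu).ne_zero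
    rw [det_eq_prod_of_mem_lowerSubmodule hAi] at h
    exact fun i => Finset.prod_ne_zero_iff.1 h i (Finset.mem_univ i)
  set d := LDL.diagEntries hP with hd
  have hD : A⁻¹ * diagonal d * (A⁻¹)ᵀ = P := by
    have := LDL.lower_conj_diag hP
    rwa [conjTranspose_eq_transpose_of_trivial] at this
  have hdpos : ∀ i, 0 < d i := by
    have h1 : diagonal d = A * P * Aᴴ := LDL.diag_eq_lowerInv_conj hP
    have h2 : (A * P * Aᴴ).PosDef := hP.mul_mul_conjTranspose_same
      (Matrix.vecMul_injective_of_isUnit ((Matrix.isUnit_iff_isUnit_det A).2 hAu))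
    rw [← h1] at h2
    exact Matrix.posDef_diagonal_iff.1 h2
  -- The diagonal of A⁻¹ is only known to be nonzero; the sign makes the new diagonal positive and
  -- squares to 1.
  let s : Fin n → ℝ := fun i => SignType.sign (A⁻¹ i i) * √(d i)
  have hsl : diagonal s ∈ lowerSubmodule n := fun i j hij => Matrix.diagonal_apply_ne _ hij.ne
  refine ⟨A⁻¹ * diagonal s, mul_mem_lowerSubmodule hAi hsl, fun i => ?_, ?_⟩
  · rw [mul_apply_diag_of_lower hAi hsl, Matrix.diagonal_apply_eq]
    change 0 < A⁻¹ i i * (SignType.sign (A⁻¹ i i) * √(d i))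
    rw [← mul_assoc, self_mul_sign]
    exact mul_pos (abs_pos.2 (hAd i)) (Real.sqrt_pos.2 (hdpos i))
  · have hss : diagonal s * (diagonal s)ᵀ = diagonal d := by
      rw [diagonal_transpose, diagonal_mul_diagonal]
      congr 1
      funext i
      change (SignType.sign (A⁻¹ i i) * √(d i)) * (SignType.sign (A⁻¹ i i) * √(d i)) = d i
      have h1 : (SignType.sign (A⁻¹ i i) : ℝ) * SignType.sign (A⁻¹ i i) = 1 := by
        rcases lt_or_gt_of_ne (hAd i) with h | h
        · simp [sign_neg h]
        · simp [sign_pos h]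
      rw [mul_mul_mul_comm, h1, one_mul, Real.mul_self_sqrt (hdpos i).le]
    rw [transpose_mul, ← hD, ← hss]
    simp only [mul_assoc]

theorem isCholeskyFactor_cholesky {P : Mat n} (hP : P.PosDef) :
    IsCholeskyFactor P (cholesky P) :=
  Classical.epsilon_spec (exists_isCholeskyFactor hP)

theorem IsCholeskyFactor.posDef {P L : Mat n} (h : IsCholeskyFactor P L) : P.PosDef := by
  rw [← h.mul_transpose, ← conjTranspose_eq_transpose_of_trivial]
  exact Matrix.PosDef.mul_conjTranspose_self _
    (Matrix.vecMul_injective_of_isUnit ((Matrix.isUnit_iff_isUnit_det L).2 h.isUnit_det))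

theorem IsCholeskyFactor.cholesky_eq {P L : Mat n} (h : IsCholeskyFactor P L) : cholesky P = L :=
  (isCholeskyFactor_cholesky h.posDef).unique h

theorem lowerHalf_mem (Z : Mat n) : lowerHalf Z ∈ lowerSubmodule n := by
  intro i j hij
  simp [lowerHalf, hij.not_gt, hij.ne]

theorem lowerHalf_add_transpose {Z : Mat n} (hZ : Z.IsSymm) :
    lowerHalf Z + (lowerHalf Z)ᵀ = Z := by
  ext i j
  rcases lt_trichotomy i j with h | rfl | h
  · simp [lowerHalf, h, h.not_gt, h.ne, hZ.apply j i]
  · simp [lowerHalf]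
  · simp [lowerHalf, h, h.not_gt, h.ne]

theorem lowerHalf_add_transpose_of_lower {Z : Mat n} (hZ : Z ∈ lowerSubmodule n) :
    lowerHalf (Z + Zᵀ) = Z := by
  ext i j
  rcases lt_trichotomy i j with h | rfl | h
  · simp [lowerHalf, h.not_gt, h.ne, hZ i j h]
  · simp [lowerHalf]
  · simp [lowerHalf, h, hZ j i h]

/-- Conjugating by L⁻¹ turns the argument into Z + Zᵀ with Z = L⁻¹X lower triangular, and
`lowerHalf` recovers Z. -/
theorem IsCholeskyFactor.dCholesky_eq {P L X : Mat n} (h : IsCholeskyFactor P L)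
    (hX : X ∈ lowerSubmodule n) : dCholesky P (X * Lᵀ + L * Xᵀ) = X := by
  have hu := h.isUnit_det
  have hut : IsUnit (Lᵀ).det := Matrix.isUnit_det_transpose L hu
  rw [dCholesky, h.cholesky_eq, Matrix.transpose_nonsing_inv]
  have h1 : L⁻¹ * (X * Lᵀ + L * Xᵀ) * Lᵀ⁻¹ = L⁻¹ * X + (L⁻¹ * X)ᵀ := by
    rw [mul_add, add_mul, transpose_mul, Matrix.transpose_nonsing_inv, ← mul_assoc L⁻¹ X,
      Matrix.mul_nonsing_inv_cancel_right _ _ hut, Matrix.nonsing_inv_mul_cancel_left _ _ hu]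
  rw [h1, lowerHalf_add_transpose_of_lower
    (mul_mem_lowerSubmodule (inv_mem_lowerSubmodule h.lower hu) hX),
    Matrix.mul_nonsing_inv_cancel_left _ _ hu]

theorem IsCholeskyFactor.dCholesky_mem {P L : Mat n} (h : IsCholeskyFactor P L) (V : Mat n) :
    dCholesky P V ∈ lowerSubmodule n := by
  rw [dCholesky, h.cholesky_eq]
  exact mul_mem_lowerSubmodule h.lower (lowerHalf_mem _)

theorem IsCholeskyFactor.dCholesky_mul_add {P L V : Mat n} (h : IsCholeskyFactor P L)
    (hV : V.IsSymm) : dCholesky P V * Lᵀ + L * (dCholesky P V)ᵀ = V := by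
  have hu := h.isUnit_det
  have hut : IsUnit (Lᵀ).det := Matrix.isUnit_det_transpose L hu
  have hs : (L⁻¹ * V * (L⁻¹)ᵀ).IsSymm := by
    rw [Matrix.IsSymm, transpose_mul, transpose_mul, transpose_transpose, hV.eq, mul_assoc]
  rw [dCholesky, h.cholesky_eq, transpose_mul, ← mul_assoc, ← add_mul, ← mul_add,
    lowerHalf_add_transpose hs, Matrix.transpose_nonsing_inv, mul_assoc L⁻¹,
    Matrix.mul_nonsing_inv_cancel_left _ _ hu, Matrix.nonsing_inv_mul_cancel_right _ _ hut]

end Cholesky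

/-! ### The Log-Cholesky chart -/

section LogCholesky

/-- The matrix with the diagonal entries replaced by their exponentials. -/
def diagExp (Y : Mat n) : Mat n :=
  Matrix.of fun i j => if i = j then Real.exp (Y i j) else Y i j

/-- The differential of `diagExp`. -/
def dDiagExp (Y A : Mat n) : Mat n :=
  Matrix.of fun i j => if i = j then Real.exp (Y i j) * A i j else A i j

/-- The entries of a matrix as a function, as a continuous linear equivalence. -/
def ofL (n : ℕ) : (Fin n → Fin n → ℝ) ≃L[ℝ] Mat n :=
  (Matrix.ofLinearEquiv ℝ).toContinuousLinearEquiv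

theorem contDiff_mat {E : Type*} [NormedAddCommGroup E] [NormedSpace ℝ E] {k : WithTop ℕ∞}
    {f : E → Mat n} (hf : ∀ i j, ContDiff ℝ k fun x => f x i j) : ContDiff ℝ k f :=
  (ofL n).contDiff.comp (contDiff_pi.2 fun i => contDiff_pi.2 fun j => hf i j)

theorem hasDerivAt_mat {f : ℝ → Mat n} {f' : Mat n} {t : ℝ}
    (hf : ∀ i j, HasDerivAt (fun x => f x i j) (f' i j) t) : HasDerivAt f f' t :=
  (ofL n : (Fin n → Fin n → ℝ) →L[ℝ] Mat n).hasFDerivAt.comp_hasDerivAt t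
    (hasDerivAt_pi.2 fun i => hasDerivAt_pi.2 fun j => hf i j)

theorem contDiff_entry {k : WithTop ℕ∞} (i j : Fin n) : ContDiff ℝ k fun X : Mat n => X i j :=
  (LinearMap.toContinuousLinearMap (Matrix.entryLinearMap ℝ ℝ i j)).contDiff

theorem contDiff_diagExp {k : WithTop ℕ∞} : ContDiff ℝ k (diagExp : Mat n → Mat n) := by
  refine contDiff_mat fun i j => ?_
  simp only [diagExp, Matrix.of_apply]
  split_ifs
  · exact (contDiff_entry i j).exp
  · exact contDiff_entry i j

theorem hasDerivAt_diagExp_line (Y A : Mat n) :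
    HasDerivAt (fun t : ℝ => diagExp (Y + t • A)) (dDiagExp Y A) 0 := by
  refine hasDerivAt_mat fun i j => ?_
  have h : HasDerivAt (fun t : ℝ => (Y + t • A) i j) (A i j) 0 :=
    hasDerivAt_affine (Y i j) (A i j) 0
  simp only [diagExp, dDiagExp, Matrix.of_apply]
  split_ifs
  · simpa using h.exp
  · exact h

/-- The inverse `Y ↦ L Lᵀ`, `L = diagExp Y`, of the Log-Cholesky chart. -/
def expCholesky (Y : lowerSubmodule n) : Mat n := diagExp (Y : Mat n) * (diagExp (Y : Mat n))ᵀ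

theorem isCholeskyFactor_expCholesky (Y : lowerSubmodule n) :
    IsCholeskyFactor (expCholesky Y) (diagExp (Y : Mat n)) where
  lower i j hij := by simp [diagExp, hij.ne, Y.2 i j hij]
  diag_pos i := by simp [diagExp, Real.exp_pos]
  mul_transpose := rfl

theorem dDiagExp_mem (Y A : lowerSubmodule n) :
    dDiagExp (Y : Mat n) (A : Mat n) ∈ lowerSubmodule n := fun i j hij => by
  simp [dDiagExp, hij.ne, A.2 i j hij]

theorem contDiff_expCholesky {k : WithTop ℕ∞} :
    ContDiff ℝ k (expCholesky : lowerSubmodule n → Mat n) := by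
  have h : ContDiff ℝ k fun Y : lowerSubmodule n => diagExp (Y : Mat n) :=
    contDiff_diagExp.comp (lowerSubmodule n).subtypeL.contDiff
  exact h.mul ((transposeL n).contDiff.comp h)

theorem fderiv_expCholesky (Y A : lowerSubmodule n) : fderiv ℝ expCholesky Y A =
    dDiagExp (Y : Mat n) (A : Mat n) * (diagExp (Y : Mat n))ᵀ +
      diagExp (Y : Mat n) * (dDiagExp (Y : Mat n) (A : Mat n))ᵀ := by
  have h1 := hasDerivAt_comp_affine (t := 0) Y A
    ((contDiff_expCholesky (k := 1)).differentiable one_ne_zero _)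
  have h2 := hasDerivAt_diagExp_line (Y : Mat n) (A : Mat n)
  have h3 : HasDerivAt (fun t : ℝ => (diagExp ((Y : Mat n) + t • (A : Mat n)))ᵀ)
      (dDiagExp (Y : Mat n) (A : Mat n))ᵀ 0 := (transposeL n).hasFDerivAt.comp_hasDerivAt (0 : ℝ) h2
  have h4 := h1.unique (h2.mul h3)
  simpa only [zero_smul, add_zero] using h4

/-- The strictly lower part of a matrix together with the logarithms of its diagonal entries. -/
def diagLog (L : Mat n) : lowerSubmodule n :=
  ⟨Matrix.of fun i j => if i = j then Real.log (L i j) else if j < i then L i j else 0,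
    fun i j hij => by simp [hij.ne, hij.not_gt]⟩

theorem diagExp_diagLog {L : Mat n} (hL : L ∈ lowerSubmodule n) (hd : ∀ i, 0 < L i i) :
    diagExp (diagLog L : Mat n) = L := by
  ext i j
  rcases lt_trichotomy i j with h | rfl | h
  · simp [diagExp, diagLog, h.ne, h.not_gt, hL i j h]
  · simp [diagExp, diagLog, Real.exp_log (hd i)]
  · simp [diagExp, diagLog, h.ne', h]

theorem diagLog_diagExp (Y : lowerSubmodule n) : diagLog (diagExp (Y : Mat n)) = Y := by
  ext i j
  rcases lt_trichotomy i j with h | rfl | h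
  · simp [diagExp, diagLog, h.ne, h.not_gt, Y.2 i j h]
  · simp [diagExp, diagLog]
  · simp [diagExp, diagLog, h.ne', h]

/-- The Log-Cholesky chart of `Sym_n⁺`. -/
def logCholeskyChart (n : ℕ) : SPDChart n (lowerSubmodule n) :=
  SPDChart.ofInverse expCholesky (fun P => diagLog (cholesky P)) contDiff_expCholesky
    (fun Y => (isCholeskyFactor_expCholesky Y).posDef)
    (fun Y A h => by
      rw [fderiv_expCholesky] at h
      have h1 := (isCholeskyFactor_expCholesky Y).dCholesky_eq (dDiagExp_mem Y A)
      have h2 := (isCholeskyFactor_expCholesky Y).dCholesky_eq (zero_mem (lowerSubmodule n))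
      rw [h] at h1
      simp only [zero_mul, transpose_zero, mul_zero, add_zero] at h2
      rw [h2] at h1
      ext i j
      have h3 := congrFun (congrFun h1 i) j
      by_cases hij : i = j
      · simpa [dDiagExp, hij, (Real.exp_pos _).ne'] using h3.symm
      · simpa [dDiagExp, hij] using h3.symm)
    (fun Y V hV => by
      have hc := isCholeskyFactor_expCholesky Y
      -- Divide out the factors exp(Y_ii) that `dDiagExp` puts on the diagonal.
      let A : Mat n := Matrix.of fun i j =>
        if i = j then dCholesky (expCholesky Y) V i j / Real.exp ((Y : Mat n) i j)
        else dCholesky (expCholesky Y) V i j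
      have hA : A ∈ lowerSubmodule n := fun i j hij => by
        simp [A, hij.ne, hc.dCholesky_mem V i j hij]
      have hAd : dDiagExp (Y : Mat n) A = dCholesky (expCholesky Y) V := by
        ext i j
        by_cases hij : i = j
        · simp [dDiagExp, A, hij, mul_div_cancel₀, (Real.exp_pos _).ne']
        · simp [dDiagExp, A, hij]
      refine ⟨⟨A, hA⟩, ?_⟩
      rw [fderiv_expCholesky, hAd]
      exact hc.dCholesky_mul_add hV)
    (fun Y => by rw [(isCholeskyFactor_expCholesky Y).cholesky_eq, diagLog_diagExp])
    (fun P hP => by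
      have hc := isCholeskyFactor_cholesky hP
      rw [expCholesky, diagExp_diagLog hc.lower hc.diag_pos, hc.mul_transpose])

theorem cholesky_eq_diagExp {P : Mat n} (hP : P.PosDef) :
    cholesky P = diagExp ((logCholeskyChart n).toFun P : Mat n) := by
  rw [← (isCholeskyFactor_expCholesky _).cholesky_eq]
  exact congrArg cholesky ((logCholeskyChart n).left_inv P hP).symm

theorem dCholesky_eq_dDiagExp {P V : Mat n} (hP : P.PosDef) (hV : V.IsSymm) :
    dCholesky P V = dDiagExp ((logCholeskyChart n).toFun P : Mat n)
      (fderiv ℝ (logCholeskyChart n).toFun P V : Mat n) := by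
  have h1 : fderiv ℝ expCholesky ((logCholeskyChart n).toFun P)
      (fderiv ℝ (logCholeskyChart n).toFun P V) = V :=
    (logCholeskyChart n).fderiv_invFun_fderiv_toFun hP hV
  have h2 : expCholesky ((logCholeskyChart n).toFun P) = P := (logCholeskyChart n).left_inv P hP
  have h3 := (isCholeskyFactor_expCholesky ((logCholeskyChart n).toFun P)).dCholesky_eq
    (dDiagExp_mem ((logCholeskyChart n).toFun P) (fderiv ℝ (logCholeskyChart n).toFun P V))
  rwa [← fderiv_expCholesky, h1, h2] at h3

/-- The exponentials on the diagonal cancel against L_ii², and lower triangularity of A removes the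
strictly upper terms of the Frobenius product. -/
theorem triMetric_diagExp (Y : Mat n) {A B : Mat n} (hA : A ∈ lowerSubmodule n) :
    triMetric n (diagExp Y) (dDiagExp Y A) (dDiagExp Y B) = frobenius A B := by
  rw [triMetric, frobenius, ← Finset.sum_add_distrib]
  refine Finset.sum_congr rfl fun i _ => ?_
  have h1 : dDiagExp Y A i i * dDiagExp Y B i i / diagExp Y i i ^ 2 =
      ∑ j, if j = i then A i j * B i j else 0 := by
    have := (Real.exp_pos (Y i i)).ne'
    simp only [dDiagExp, diagExp, Matrix.of_apply, if_true, Finset.sum_ite_eq', Finset.mem_univ]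
    field_simp
  rw [h1, ← Finset.sum_add_distrib]
  refine Finset.sum_congr rfl fun j _ => ?_
  rcases lt_trichotomy i j with h | rfl | h
  · simp [h.not_gt, h.ne', hA i j h]
  · simp
  · simp [h, h.ne, h.ne', dDiagExp]

/-- The Log-Cholesky chart is flat for the Log-Cholesky metric. -/
def lcChart (n : ℕ) : FlatChart (lcMetric n) (lowerSubmodule n) where
  toSPDChart := logCholeskyChart n
  form := frobeniusOn (lowerSubmodule n)
  form_symm x y := frobenius_comm _ _
  form_self x h := Subtype.ext (eq_zero_of_frobenius_self h)
  metric_eq P V W hP hV hW := by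
    rw [frobeniusOn_apply, lcMetric, cholesky_eq_diagExp hP, dCholesky_eq_dDiagExp hP hV,
      dCholesky_eq_dDiagExp hP hW, triMetric_diagExp _ (Subtype.prop _)]

end LogCholesky

/-! ### The Affine-Invariant metric: covariant derivative -/

section AffineInvariant

theorem isUnit_det_of_posDef {P : Mat n} (hP : P.PosDef) : IsUnit P.det :=
  hP.det_pos.ne'.isUnit

theorem hasDerivWithinAt_inv {γ : ℝ → Mat n} {v : Mat n} {s : Set ℝ} {t : ℝ}
    (hP : IsUnit (γ t).det) (h : HasDerivWithinAt γ v s t) :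
    HasDerivWithinAt (fun t => (γ t)⁻¹) (-((γ t)⁻¹ * v * (γ t)⁻¹)) s t := by
  obtain ⟨u, hu⟩ := (Matrix.isUnit_iff_isUnit_det _).2 hP
  have h1 := hasFDerivAt_ringInverse (𝕜 := ℝ) u
  rw [hu] at h1
  have h2 := h1.comp_hasDerivWithinAt t h
  have h3 : (fun t => (γ t)⁻¹) = Ring.inverse ∘ γ := by
    funext t
    exact Matrix.nonsing_inv_eq_ringInverse _
  have h4 : ((u⁻¹ : (Mat n)ˣ) : Mat n) = (γ t)⁻¹ := by rw [Matrix.coe_units_inv, hu]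
  rw [h3]
  simpa [h4] using h2

/-- The trace as a continuous linear map. -/
def traceL (n : ℕ) : Mat n →L[ℝ] ℝ :=
  LinearMap.toContinuousLinearMap (Matrix.traceLinearMap (Fin n) ℝ ℝ)

theorem lineDeriv_aiMetric {P : Mat n} (hP : P.PosDef) (U V W : Mat n) :
    lineDeriv ℝ (fun X : Mat n => aiMetric n X V W) P U =
      -(P⁻¹ * U * P⁻¹ * V * P⁻¹ * W).trace - (P⁻¹ * V * P⁻¹ * U * P⁻¹ * W).trace := by
  have h1 := hasDerivWithinAt_inv (γ := fun t : ℝ => P + t • U) (t := 0)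
    (by simpa using isUnit_det_of_posDef hP) (hasDerivAt_affine P U 0).hasDerivWithinAt (s := univ)
  rw [hasDerivWithinAt_univ] at h1
  simp only [zero_smul, add_zero] at h1
  have h2 := ((h1.mul_const V).mul h1).mul_const W
  have h3 : HasDerivAt (fun t : ℝ => aiMetric n (P + t • U) V W) _ 0 :=
    (traceL n).hasFDerivAt.comp_hasDerivAt (0 : ℝ) h2
  refine h3.deriv.trans ?_
  change Matrix.trace (_ : Mat n) = _
  simp only [zero_smul, add_zero, neg_mul, mul_neg, ← mul_assoc, Matrix.trace_add,
    Matrix.trace_neg, add_mul]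
  ring

/-- Reads off the covariant derivative X' − ½(vP⁻¹X + XP⁻¹v). Cyclicity of the trace identifies the
W-derivative terms of Koszul's formula with the others. -/
theorem aiMetric_add_christoffel {P : Mat n} (hP : P.PosDef) (v X X' W : Mat n) :
    aiMetric n P X' W + christoffel (aiMetric n) P v X W =
      (P⁻¹ * (X' - (2⁻¹ : ℝ) • (v * P⁻¹ * X + X * P⁻¹ * v)) * P⁻¹ * W).trace := by
  have h1 : (P⁻¹ * W * P⁻¹ * v * P⁻¹ * X).trace = (P⁻¹ * v * P⁻¹ * X * P⁻¹ * W).trace := by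
    have := Matrix.trace_mul_comm (P⁻¹ * W) (P⁻¹ * v * P⁻¹ * X)
    simpa only [← mul_assoc] using this
  have h2 : (P⁻¹ * v * P⁻¹ * W * P⁻¹ * X).trace = (P⁻¹ * X * P⁻¹ * v * P⁻¹ * W).trace := by
    have := Matrix.trace_mul_comm (P⁻¹ * v * P⁻¹ * W) (P⁻¹ * X)
    simpa only [← mul_assoc] using this
  rw [christoffel, lineDeriv_aiMetric hP, lineDeriv_aiMetric hP, lineDeriv_aiMetric hP, h1, h2,
    aiMetric]
  simp only [mul_sub, sub_mul, mul_add, add_mul, Matrix.mul_smul, Matrix.smul_mul, ← mul_assoc,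
    Matrix.trace_sub, Matrix.trace_smul, Matrix.trace_add, smul_eq_mul, smul_add]
  ring

theorem isSymm_conj {A S : Mat n} (hA : A.IsSymm) (hS : S.IsSymm) : (A * S * A).IsSymm := by
  rw [Matrix.IsSymm, transpose_mul, transpose_mul, hA.eq, hS.eq, mul_assoc]

theorem isSymm_inv {A : Mat n} (hA : A.IsSymm) : (A⁻¹).IsSymm := by
  rw [Matrix.IsSymm, Matrix.transpose_nonsing_inv, hA.eq]

theorem eq_zero_of_trace_mul_self {Y : Mat n} (hY : Y.IsSymm) (h : (Y * Y).trace = 0) : Y = 0 := by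
  refine eq_zero_of_frobenius_self ?_
  rw [← h]
  simp only [frobenius, Matrix.trace, Matrix.diag_apply, Matrix.mul_apply]
  exact Finset.sum_congr rfl fun i _ => Finset.sum_congr rfl fun j _ => by rw [hY.apply i j]

theorem hasDerivWithinAt_of_isParallelAlong_aiMetric {γ v X : ℝ → Mat n} (hγ : IsCurve γ v)
    (hv : ∀ t ∈ Icc (0 : ℝ) 1, (v t).IsSymm) (hX : IsParallelAlong (aiMetric n) γ v X) {t : ℝ}
    (ht : t ∈ Icc (0 : ℝ) 1) :
    HasDerivWithinAt X ((2⁻¹ : ℝ) • (v t * (γ t)⁻¹ * X t + X t * (γ t)⁻¹ * v t)) (Icc 0 1) t := by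
  obtain ⟨hXs, X', hX', hW⟩ := hX t ht
  have hP := (hγ t ht).1
  have hPu := isUnit_det_of_posDef hP
  have hPi := isSymm_inv (isSymm_of_posDef hP)
  have hsX' := isSymm_of_hasDerivWithinAt ht hX' fun r hr => (hX r hr).1
  have hZ : (X' - (2⁻¹ : ℝ) • (v t * (γ t)⁻¹ * X t + X t * (γ t)⁻¹ * v t)).IsSymm := by
    refine hsX'.sub (Matrix.IsSymm.smul ?_ _)
    rw [Matrix.IsSymm]
    simp only [transpose_add, transpose_mul, hXs.eq, (hv t ht).eq, hPi.eq, ← mul_assoc]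
    rw [add_comm]
  have hY := isSymm_conj hPi hZ
  -- With Z the covariant derivative, testing against Y = γ⁻¹Zγ⁻¹ gives tr(Y²) = 0, so Y = 0 and Z =
  -- 0.
  have h1 := hW _ hY
  rw [aiMetric_add_christoffel hP] at h1
  have h2 := eq_zero_of_trace_mul_self hY (by simpa only [mul_assoc] using h1)
  have hu : IsUnit (γ t)⁻¹ := by
    rw [Matrix.isUnit_nonsing_inv_iff, Matrix.isUnit_iff_isUnit_det]
    exact hPu
  have h3 := hu.mul_left_eq_zero.1 h2
  have h4 := hu.mul_right_eq_zero.1 h3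
  rwa [sub_eq_zero.1 h4] at hX'

theorem isParallelAlong_aiMetric {γ v X : ℝ → Mat n} (hγ : IsCurve γ v)
    (hXs : ∀ t ∈ Icc (0 : ℝ) 1, (X t).IsSymm)
    (hX : ∀ t ∈ Icc (0 : ℝ) 1, HasDerivWithinAt X
      ((2⁻¹ : ℝ) • (v t * (γ t)⁻¹ * X t + X t * (γ t)⁻¹ * v t)) (Icc 0 1) t) :
    IsParallelAlong (aiMetric n) γ v X := fun t ht =>
  ⟨hXs t ht, _, hX t ht, fun W _ => by rw [aiMetric_add_christoffel (hγ t ht).1]; simp⟩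

/-! ### Geodesics and parallel transport of the Affine-Invariant metric -/

theorem hasDerivAt_exp_smul (A : Mat n) (t : ℝ) :
    HasDerivAt (fun t : ℝ => exp (t • A)) (A * exp (t • A)) t :=
  hasDerivAt_exp_smul_const' A t

theorem exp_neg_smul_mul_cancel (A : Mat n) (t : ℝ) : exp (t • -A) * exp (t • A) = 1 := by
  have h : Commute (t • -A) (t • A) := by
    rw [smul_neg]; exact (Commute.refl (t • A)).neg_left
  rw [← Matrix.exp_add_of_commute _ _ h, smul_neg, neg_add_cancel, exp_zero]

theorem exp_smul_mul_neg_cancel (A : Mat n) (t : ℝ) : exp (t • A) * exp (t • -A) = 1 :=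
  mul_eq_one_comm.1 (exp_neg_smul_mul_cancel A t)

theorem commute_exp_smul (A : Mat n) (t : ℝ) : Commute A (exp (t • A)) :=
  ((Commute.refl A).smul_right t).exp_right

/-- The geodesic equation is v' = vγ⁻¹v, which makes the derivative of γ⁻¹v vanish. -/
theorem isGeodesic_aiMetric_velocity {γ v : ℝ → Mat n} (h : IsGeodesic (aiMetric n) γ v) {t : ℝ}
    (ht : t ∈ Icc (0 : ℝ) 1) : v t = γ t * ((γ 0)⁻¹ * v 0) := by
  have h1 := eq_of_hasDerivWithinAt_zero (f := fun t => (γ t)⁻¹ * v t) (fun s hs => by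
    have hP := isUnit_det_of_posDef (h.1 s hs).1
    have hv := hasDerivWithinAt_of_isParallelAlong_aiMetric h.1 (fun s hs => (h.2 s hs).1) h.2 hs
    have := (hasDerivWithinAt_inv hP (h.1 s hs).2).mul hv
    refine this.congr_deriv ?_
    rw [← two_smul ℝ, smul_smul]
    norm_num [mul_assoc]) ht
  rw [← h1, Matrix.mul_nonsing_inv_cancel_left _ _ (isUnit_det_of_posDef (h.1 t ht).1)]

/-- Solves γ' = γS by the integrating factor exp(−tS). This is also the uniqueness of geodesics with
given initial data. -/
theorem isGeodesic_aiMetric_eq {γ v : ℝ → Mat n} (h : IsGeodesic (aiMetric n) γ v) {t : ℝ}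
    (ht : t ∈ Icc (0 : ℝ) 1) : γ t = γ 0 * exp (t • ((γ 0)⁻¹ * v 0)) := by
  set S := (γ 0)⁻¹ * v 0 with hS
  have h1 := eq_of_hasDerivWithinAt_zero (f := fun t => γ t * exp (t • -S)) (fun s hs => by
    have hd := (h.1 s hs).2
    rw [isGeodesic_aiMetric_velocity h hs, ← hS] at hd
    have := hd.mul (hasDerivAt_exp_smul (-S) s).hasDerivWithinAt
    refine this.congr_deriv ?_
    rw [neg_mul, mul_neg, mul_assoc, add_neg_cancel]) ht
  simp only [zero_smul, exp_zero, mul_one] at h1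
  rw [← h1, mul_assoc, exp_neg_smul_mul_cancel, mul_one]

/-- R = 1 gives the geodesics from I, and R = P^{1/2} those from P. -/
theorem isGeodesic_conj_exp {R T : Mat n} (hR : R.IsSymm) (hRu : IsUnit R.det) (hT : T.IsSymm) :
    IsGeodesic (aiMetric n) (fun t => R * exp (t • T) * R)
      (fun t => R * (T * exp (t • T)) * R) := by
  have hc : IsCurve (fun t => R * exp (t • T) * R) (fun t => R * (T * exp (t • T)) * R) := by
    refine fun t _ => ⟨?_, (((hasDerivAt_exp_smul T t).const_mul R).mul_const R).hasDerivWithinAt⟩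
    have h := (exp_posDef (hT.smul t)).mul_mul_conjTranspose_same (B := R)
      (Matrix.vecMul_injective_of_isUnit ((Matrix.isUnit_iff_isUnit_det R).2 hRu))
    rwa [conjTranspose_eq_transpose_of_trivial, hR.eq] at h
  refine ⟨hc, isParallelAlong_aiMetric hc (fun t _ => isSymm_conj hR ?_) fun t _ => ?_⟩
  · rw [Matrix.IsSymm, transpose_mul, hT.eq, (isSymm_of_posDef (exp_posDef (hT.smul t))).eq]
    exact (commute_exp_smul T t).eq.symm
  · have hd := ((((hasDerivAt_exp_smul T t).const_mul T).const_mul R).mul_const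
      R).hasDerivWithinAt (s := Icc 0 1)
    refine hd.congr_deriv (Eq.symm ?_)
    have hi : (R * exp (t • T) * R)⁻¹ = R⁻¹ * exp (t • -T) * R⁻¹ := by
      refine Matrix.inv_eq_left_inv ?_
      rw [mul_assoc, ← mul_assoc R⁻¹, ← mul_assoc R⁻¹, Matrix.nonsing_inv_mul _ hRu, one_mul,
        mul_assoc, ← mul_assoc (exp (t • -T)), exp_neg_smul_mul_cancel, one_mul,
        Matrix.nonsing_inv_mul _ hRu]
    have h1 : R * (T * exp (t • T)) * R * (R⁻¹ * exp (t • -T) * R⁻¹) = R * T * R⁻¹ := by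
      rw [mul_assoc R⁻¹, mul_assoc _ R, Matrix.mul_nonsing_inv_cancel_left _ _ hRu,
        mul_assoc R, mul_assoc T, ← mul_assoc (exp (t • T)), exp_smul_mul_neg_cancel, one_mul,
        mul_assoc R]
    have h2 : R * T * R⁻¹ * (R * (T * exp (t • T)) * R) = R * (T * (T * exp (t • T))) * R := by
      rw [mul_assoc R (T * exp (t • T)), mul_assoc (R * T),
        Matrix.nonsing_inv_mul_cancel_left _ _ hRu]
      simp only [mul_assoc]
    rw [hi, h1, h2, ← two_smul ℝ, smul_smul]
    norm_num

/-- The symmetric square root of a positive definite matrix. -/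
def spdSqrt (P : Mat n) : Mat n := exp ((2⁻¹ : ℝ) • matLog P)

theorem posDef_spdSqrt (P : Mat n) : (spdSqrt P).PosDef :=
  exp_posDef ((matLog_isSymm P).smul _)

theorem isSymm_spdSqrt (P : Mat n) : (spdSqrt P).IsSymm := isSymm_of_posDef (posDef_spdSqrt P)

theorem isUnit_det_spdSqrt (P : Mat n) : IsUnit (spdSqrt P).det :=
  isUnit_det_of_posDef (posDef_spdSqrt P)

theorem spdSqrt_mul_self {P : Mat n} (hP : P.PosDef) : spdSqrt P * spdSqrt P = P := by
  rw [spdSqrt, ← Matrix.exp_add_of_commute _ _ (Commute.refl _), ← add_smul]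
  norm_num [exp_matLog hP]

theorem isGeodesic_aiMetric_from_one {γ v : ℝ → Mat n} (h : IsGeodesic (aiMetric n) γ v)
    (h0 : γ 0 = 1) {t : ℝ} (ht : t ∈ Icc (0 : ℝ) 1) :
    γ t = exp (t • v 0) ∧ v t = γ t * v 0 := by
  have h1 := isGeodesic_aiMetric_eq h ht
  have h2 := isGeodesic_aiMetric_velocity h ht
  rw [h0] at h1 h2
  exact ⟨by simpa using h1, by simpa using h2⟩

theorem velocity_eq_matLog {γ v : ℝ → Mat n} (h : IsGeodesic (aiMetric n) γ v)
    (h0 : γ 0 = 1) : v 0 = matLog (γ 1) := by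
  have h1 := (isGeodesic_aiMetric_from_one h h0 ⟨zero_le_one, le_rfl⟩).1
  rw [h1, one_smul, matLog_exp (h.2 0 ⟨le_rfl, zero_le_one⟩).1]

theorem isGeodesic_exp {T : Mat n} (hT : T.IsSymm) :
    IsGeodesic (aiMetric n) (fun t => exp (t • T)) (fun t => T * exp (t • T)) := by
  simpa using isGeodesic_conj_exp Matrix.isSymm_one (by simp) hT

theorem riemLog_aiMetric_one (Q : SPD n) :
    riemLog (aiMetric n) (SPD.one n) Q = matLog Q.1 := by
  have hex : ∃ V : Mat n, ∃ γ v, IsGeodesic (aiMetric n) γ v ∧ γ 0 = (SPD.one n).1 ∧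
      γ 1 = Q.1 ∧ v 0 = V :=
    ⟨_, _, _, isGeodesic_exp (matLog_isSymm Q.1), by simp [SPD.one],
      by simpa using exp_matLog Q.2, rfl⟩
  obtain ⟨γ, v, hγ, h0, h1, hv⟩ := Classical.epsilon_spec hex
  rw [riemLog, ← hv, velocity_eq_matLog hγ h0, h1]

/-- Since vγ⁻¹ = γ⁻¹v = v(0), the equation is X' = ½(v(0)X + Xv(0)); multiplying X on both sides by
exp(−t v(0)/2) gives a constant. -/
theorem isParallelAlong_exp_eq {γ v X : ℝ → Mat n} (h : IsGeodesic (aiMetric n) γ v)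
    (h0 : γ 0 = 1) (hX : IsParallelAlong (aiMetric n) γ v X) {t : ℝ} (ht : t ∈ Icc (0 : ℝ) 1) :
    X t = exp (t • (2⁻¹ : ℝ) • v 0) * X 0 * exp (t • (2⁻¹ : ℝ) • v 0) := by
  set A := (2⁻¹ : ℝ) • v 0 with hA
  have hvA : v 0 = (2 : ℝ) • A := by rw [hA, smul_smul]; norm_num
  have h1 := eq_of_hasDerivWithinAt_zero (f := fun t => exp (t • -A) * X t * exp (t • -A))
    (fun s hs => by
      obtain ⟨hγs, hvs⟩ := isGeodesic_aiMetric_from_one h h0 hs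
      have hd := hasDerivWithinAt_of_isParallelAlong_aiMetric h.1 (fun s hs => (h.2 s hs).1) hX hs
      have hu := isUnit_det_of_posDef (h.1 s hs).1
      have hc : γ s * v 0 = v 0 * γ s := by rw [hγs]; exact (commute_exp_smul _ s).eq.symm
      have e1 : v s * (γ s)⁻¹ = v 0 := by
        rw [hvs, hc, Matrix.mul_nonsing_inv_cancel_right _ _ hu]
      have e2 : (γ s)⁻¹ * v s = v 0 := by
        rw [hvs, Matrix.nonsing_inv_mul_cancel_left _ _ hu]
      rw [mul_assoc (X s), e1, e2, hvA, Matrix.smul_mul, Matrix.mul_smul, ← smul_add, smul_smul,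
        inv_mul_cancel₀ two_ne_zero, one_smul] at hd
      have he := (hasDerivAt_exp_smul (-A) s).hasDerivWithinAt (s := Icc 0 1)
      have := (he.mul hd).mul he
      refine this.congr_deriv ?_
      have hce (M : Mat n) : A * (exp (s • -A) * M) = exp (s • -A) * (A * M) := by
        have h1 := (((Commute.refl A).neg_right).smul_right s).exp_right.eq
        rw [← mul_assoc, h1, mul_assoc]
      simp only [Pi.mul_apply, neg_mul, mul_neg, mul_add, add_mul, mul_assoc, hce]
      abel) ht
  simp only [zero_smul, exp_zero, mul_one, one_mul] at h1
  rw [← h1, mul_assoc (exp (t • -A)), mul_assoc, mul_assoc, mul_assoc, exp_neg_smul_mul_cancel,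
    mul_one, ← mul_assoc, exp_smul_mul_neg_cancel, one_mul]

theorem isParallelAlong_exp {T V : Mat n} (hT : T.IsSymm) (hV : V.IsSymm) :
    IsParallelAlong (aiMetric n) (fun t => exp (t • T)) (fun t => T * exp (t • T))
      (fun t => exp (t • (2⁻¹ : ℝ) • T) * V * exp (t • (2⁻¹ : ℝ) • T)) := by
  have hg := isGeodesic_exp hT
  refine isParallelAlong_aiMetric hg.1 (fun t _ => isSymm_conj
    (isSymm_of_posDef (exp_posDef ((hT.smul _).smul t))) hV) fun t ht => ?_
  have hu := isUnit_det_of_posDef (hg.1 t ht).1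
  have he := (hasDerivAt_exp_smul ((2⁻¹ : ℝ) • T) t).hasDerivWithinAt (s := Icc 0 1)
  have hd := (he.mul_const V).mul he
  have hce : exp (t • (2⁻¹ : ℝ) • T) * T = T * exp (t • (2⁻¹ : ℝ) • T) :=
    (((Commute.refl T).smul_right (2⁻¹ : ℝ)).smul_right t).exp_right.eq.symm
  refine hd.congr_deriv (Eq.symm ?_)
  have hi : (exp (t • T))⁻¹ * (T * exp (t • T)) = T := by
    rw [(commute_exp_smul T t).eq, Matrix.nonsing_inv_mul_cancel_left _ _ hu]
  rw [Matrix.mul_nonsing_inv_cancel_right _ _ hu, mul_assoc _ (exp (t • T))⁻¹, hi, smul_add]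
  simp only [mul_assoc, Matrix.smul_mul, Matrix.mul_smul, hce]

theorem transport_aiMetric_one (P : SPD n) {V : Mat n} (hV : V.IsSymm) :
    transport (aiMetric n) (SPD.one n) P V = spdSqrt P.1 * V * spdSqrt P.1 := by
  have hl := matLog_isSymm P.1
  have hex : ∃ W : Mat n, ∃ γ v X, IsGeodesic (aiMetric n) γ v ∧ γ 0 = (SPD.one n).1 ∧
      γ 1 = P.1 ∧ IsParallelAlong (aiMetric n) γ v X ∧ X 0 = V ∧ X 1 = W :=
    ⟨_, _, _, _, isGeodesic_exp hl, by simp [SPD.one], by simpa using exp_matLog P.2,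
      isParallelAlong_exp hl hV, by simp, rfl⟩
  obtain ⟨γ, v, X, hγ, h0, h1, hX, hX0, hX1⟩ := Classical.epsilon_spec hex
  have h := isParallelAlong_exp_eq hγ h0 hX (t := 1) ⟨zero_le_one, le_rfl⟩
  rw [velocity_eq_matLog hγ h0, h1, hX0, hX1, one_smul] at h
  exact h

theorem riemExp_aiMetric (P : SPD n) {T : Mat n} (hT : T.IsSymm) :
    (riemExp (aiMetric n) P (spdSqrt P.1 * T * spdSqrt P.1)).1 =
      spdSqrt P.1 * exp T * spdSqrt P.1 := by
  have hu := isUnit_det_spdSqrt P.1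
  have hg := isGeodesic_conj_exp (isSymm_spdSqrt P.1) hu hT
  have hex : ∃ Q : SPD n, ∃ γ v, IsGeodesic (aiMetric n) γ v ∧ γ 0 = P.1 ∧
      v 0 = spdSqrt P.1 * T * spdSqrt P.1 ∧ γ 1 = Q.1 :=
    ⟨⟨_, (hg.1 1 ⟨zero_le_one, le_rfl⟩).1⟩, _, _, hg,
      by simpa using spdSqrt_mul_self P.2, by simp, rfl⟩
  obtain ⟨γ, v, hγ, h0, hv, h1⟩ := Classical.epsilon_spec hex
  have h := isGeodesic_aiMetric_eq hγ (t := 1) ⟨zero_le_one, le_rfl⟩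
  -- The explicit geodesic obeys the same closed formula as the chosen one and has the same initial
  -- data, so the endpoints coincide.
  have h' := isGeodesic_aiMetric_eq hg (t := 1) ⟨zero_le_one, le_rfl⟩
  simp only [one_smul, zero_smul, exp_zero, mul_one, spdSqrt_mul_self P.2] at h'
  rw [h0, hv, h1, one_smul, ← h'] at h
  exact h

/-! ### Gyrovector operations of the Affine-Invariant metric -/

theorem gyroAdd_aiMetric (P Q : SPD n) :
    (gyroAdd (aiMetric n) P Q).1 = spdSqrt P.1 * Q.1 * spdSqrt P.1 := by
  rw [gyroAdd, riemLog_aiMetric_one, transport_aiMetric_one P (matLog_isSymm _),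
    riemExp_aiMetric P (matLog_isSymm _), exp_matLog Q.2]

/-- Only this normalization of the square root of ⊖P is used later, so ⊖P need not be identified.
The witness for its existence is exp(−log P) = P⁻¹. -/
theorem gyroNeg_aiMetric (P : SPD n) :
    spdSqrt (gyroNeg (aiMetric n) P).1 * P.1 * spdSqrt (gyroNeg (aiMetric n) P).1 = 1 := by
  have hex : ∃ N : SPD n, gyroAdd (aiMetric n) N P = SPD.one n := by
    refine ⟨⟨exp (-matLog P.1), exp_posDef (matLog_isSymm P.1).neg⟩, Subtype.ext ?_⟩
    have h : spdSqrt (exp (-matLog P.1)) = (spdSqrt P.1)⁻¹ := by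
      rw [spdSqrt, matLog_exp (matLog_isSymm P.1).neg, spdSqrt, smul_neg, Matrix.exp_neg]
    have hu := isUnit_det_spdSqrt P.1
    rw [gyroAdd_aiMetric, h]
    change (spdSqrt P.1)⁻¹ * P.1 * (spdSqrt P.1)⁻¹ = 1
    have h1 : (spdSqrt P.1)⁻¹ * (spdSqrt P.1 * spdSqrt P.1) * (spdSqrt P.1)⁻¹ = 1 := by
      rw [Matrix.nonsing_inv_mul_cancel_left _ _ hu, Matrix.mul_nonsing_inv _ hu]
    rwa [spdSqrt_mul_self P.2] at h1
  have h := congrArg Subtype.val (Classical.epsilon_spec hex)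
  rw [gyroAdd_aiMetric] at h
  exact h

theorem gyroDist_aiMetric (P Q : SPD n) : ∃ K : Mat n, K.IsSymm ∧ K * P.1 * K = 1 ∧
    (K * Q.1 * K).PosDef ∧
    gyroDist (aiMetric n) P Q = √(matLog (K * Q.1 * K) * matLog (K * Q.1 * K)).trace := by
  refine ⟨_, isSymm_spdSqrt _, gyroNeg_aiMetric P, ?_, ?_⟩
  · rw [← gyroAdd_aiMetric]
    exact Subtype.prop _
  · rw [gyroDist, spdNorm, spdInner, riemLog_aiMetric_one, gyroAdd_aiMetric, aiMetric, inv_one,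
      one_mul, mul_one]

/-- Take O = K'MK⁻¹. Since P = K⁻², OOᵀ = K'MPMK' = 1, and the factors K⁻¹ in O and Oᵀ cancel the
outer factors K. -/
theorem exists_orthogonal_conj {K K' M P : Mat n} (hK : K.IsSymm) (hK' : K'.IsSymm)
    (hM : M.IsSymm) (h : K * P * K = 1) (h' : K' * (M * P * M) * K' = 1) (Q : Mat n) :
    ∃ O : Mat n, O * Oᵀ = 1 ∧ K' * (M * Q * M) * K' = O * (K * Q * K) * Oᵀ := by
  have hu : IsUnit K.det := Matrix.isUnit_det_of_left_inverse (B := K * P) h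
  have hP : P = K⁻¹ * K⁻¹ := by
    have h1 : K⁻¹ * (K * P * K) * K⁻¹ = P := by
      rw [mul_assoc K, Matrix.nonsing_inv_mul_cancel_left _ _ hu,
        Matrix.mul_nonsing_inv_cancel_right _ _ hu]
    rw [← h1, h, mul_one]
  have ht : (K' * M * K⁻¹)ᵀ = K⁻¹ * M * K' := by
    rw [transpose_mul, transpose_mul, hK'.eq, hM.eq, (isSymm_inv hK).eq, mul_assoc]
  refine ⟨K' * M * K⁻¹, ?_, ?_⟩
  · rw [ht, ← h', hP]
    simp only [mul_assoc]
  · rw [ht, mul_assoc K⁻¹ M, mul_assoc (K' * M * K⁻¹), ← mul_assoc _ K⁻¹ (M * K'),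
      Matrix.mul_nonsing_inv_cancel_right _ _ hu, mul_assoc (K' * M),
      ← mul_assoc K⁻¹, Matrix.nonsing_inv_mul_cancel_left _ _ hu]
    simp only [mul_assoc]

theorem isGyroisometry_leftGyrotranslation_aiMetric (A : SPD n) :
    IsGyroisometry (aiMetric n) (leftGyrotranslation (aiMetric n) A) := by
  intro P Q
  obtain ⟨K, hK, hKP, hKQ, hd⟩ := gyroDist_aiMetric P Q
  obtain ⟨K', hK', hKP', -, hd'⟩ := gyroDist_aiMetric (gyroAdd (aiMetric n) A P)
    (gyroAdd (aiMetric n) A Q)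
  rw [gyroAdd_aiMetric] at hKP' hd'
  obtain ⟨O, hO, hOQ⟩ := exists_orthogonal_conj hK hK' (isSymm_spdSqrt A.1) hKP hKP' Q.1
  rw [leftGyrotranslation, leftGyrotranslation, hd, hd', hOQ, matLog_conj_orthogonal hO hKQ]
  generalize matLog (K * Q.1 * K) = L
  have hO' : Oᵀ * O = 1 := mul_eq_one_comm.1 hO
  have h1 : O * L * Oᵀ * (O * L * Oᵀ) = O * (L * L * Oᵀ) := by
    simp only [mul_assoc]
    rw [← mul_assoc Oᵀ, hO', one_mul]
  rw [h1, Matrix.trace_mul_comm, mul_assoc, hO', mul_one]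

end AffineInvariant

theorem isGyroisometry_leftGyrotranslation (g : MetricName) (P : SPD n) :
    IsGyroisometry (g.tensor n) (leftGyrotranslation (g.tensor n) P) := by
  cases g with
  | le => exact (leChart n).isGyroisometry_leftGyrotranslation P
  | lc => exact (lcChart n).isGyroisometry_leftGyrotranslation P
  | ai => exact isGyroisometry_leftGyrotranslation_aiMetric P

end SPDGyro
end

theorem mainTheorem9 (n : ℕ) (g : SPDGyro.MetricName) (P : SPDGyro.SPD n) :
    SPDGyro.IsGyroisometry (g.tensor n) (SPDGyro.leftGyrotranslation (g.tensor n) P) :=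
  SPDGyro.isGyroisometry_leftGyrotranslation g P
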